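/- **Root-exponential quantization error decay.** *Setting.* Let $D\in\mathbb R^{m\times m}$ be the difference matrix with $1$ on the diagonal and $-1$ on the sub-diagonal. For $\beta>0$ and an integer $L\ge 1$ let $\mathcal A=\{\pm(j-\tfrac12)\beta: j=1,\dots,L\}$ be the $2L$-level alphabet of step-size $\beta$, and let $Q_{\mathcal A}$ map each real number to a nearest element of $\mathcal A$ (ties broken arbitrarily). An $r$-th order $\Sigma\Delta$ scheme $Q^r_{\Sigma\Delta}$ of step-size $\beta$ is given by such an alphabet (for some $L$), such a $Q_{\mathcal A}$ and a function $\rho_r$; for $y\in\mathbb R^m$ it produces $q=Q^r_{\Sigma\Delta}(y)\in\mathcal A^m$ and state variables $u\in\mathbb R^m$ by $$q_i=Q_{\mathcal A}\big(\rho_r(u_{i-1},\dots,u_{i-r},y_i)\big),\qquad (\Delta^r u)_i=y_i-q_i,\qquad u_i=0\text{ for }i\le 0,$$ where $(\Delta u)_i=u_i-u_{i-1}$; that is, $D^ru=y-q$. (For $r=0$ this is $u=y-q$, memoryless quantization.) The scheme has stability constant $\gamma$ if $\|u\|_\infty\le\gamma$ for every input $y$, of any length, with $\|y\|_\infty\le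 1$. A linear map $\mathcal M:\mathbb R^{n_1\times n_2}\to\mathbb R^m$, $\mathcal M(X)_i=\langle X,A_i\rangle=\sum_{a,b}X_{ab}(A_i)_{ab}$, is a mean zero, unit variance sub-Gaussian operator with parameter $K$ if the entries of $A_1,\dots,A_m$ are independent, identically distributed random variables with mean $0$, variance $1$ and $\mathbb P(|\xi|>t)\le \exp(1-t^2/K)$ for all $t\ge0$. Given $q\in\mathbb R^m$ and $\gamma$, a decoder output is the first component of a minimizer $$(\hat X,\hat\nu)\in\arg\min_{(Z,\nu)}\|Z\|_*\quad\text{subject to}\quad \|D^{-r}(\mathcal M(Z)+\nu-q)\|_2\le\gamma\sqrt m,\quad \|\nu\|_2\le\epsilon\sqrt m,$$ with $\epsilon=0$ (no measurement noise); $\|\cdot\|_*$ is the nuclear norm. *Claim.* For every $K>0$ there are constants $c,c_3,C_3>0$ depending only on $K$, and for every $C>0$ there are constants $c_1,C_1,C_2>0$ depending only on $K$ and $C$, such that the following holds. Let $n_1,n_2,m\ge 0$ and $k\ge 1$ be integers, put $$\ell=\lceil c\,k\max(n_1,n_2)\rceil,\qquad \lambda=\frac m\ell,\qquad r=\Big\lfloor\Big(\frac{\lambda}{2C_1e}\Big)^{1/2}\Big\rfloor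 ,$$ (with $\lambda=0$ in the degenerate case $\ell=0$), suppose $m\ge\ell$, and let $\mathcal M:\mathbb R^{n_1\times n_2}\to\mathbb R^m$ be a mean zero, unit variance sub-Gaussian operator with parameter $K$. Then with probability exceeding $1-C_3e^{-c_3\ell}$ on the draw of $\mathcal M$, simultaneously for all $\beta>0$, all $r$-th order $\Sigma\Delta$ schemes of step-size $\beta$ with a stability constant $\gamma\le C^r r^r\beta$ (where $0^0=1$), and all $X\in\mathbb R^{n_1\times n_2}$ of rank at most $k$ with $\|\mathcal M(X)\|_\infty\le 1$ (in particular if $\|\mathcal M(X)\|_2\le1$): for $q=Q^r_{\Sigma\Delta}(\mathcal M(X))$ the decoder has an output, and every decoder output $\hat X$ satisfies $$\|\hat X-X\|_F\le C_2\,\beta\,e^{-c_1\sqrt\lambda}.$$ -/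

import Mathlib

open MeasureTheory ProbabilityTheory

noncomputable section

namespace SigmaDelta

/-! ### Matrices, norms -/

/-- The Euclidean norm of a vector in `ℝ^m` (the type `Fin m → ℝ` itself carries the sup norm). -/
def l2Norm {m : ℕ} (v : Fin m → ℝ) : ℝ := √(∑ i, v i ^ 2)

/-- The Frobenius norm of a matrix. -/
def frobNorm {n₁ n₂ : ℕ} (X : Matrix (Fin n₁) (Fin n₂) ℝ) : ℝ := √(∑ a, ∑ b, X a b ^ 2)

/-- The nuclear norm: the sum of the singular values. Mathlib's sequence of singular values of a
map out of `ℝ^{n₂}` is indexed from `0` and vanishes from index `n₂` on. -/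
def nuclearNorm {n₁ n₂ : ℕ} (X : Matrix (Fin n₁) (Fin n₂) ℝ) : ℝ :=
  ∑ i ∈ Finset.range n₂, (Matrix.toEuclideanLin X).singularValues i

/-- The measurement operator `X ↦ (⟨X, A i⟩)_i` given by matrices `A 0, …, A (m - 1)` and the
Hilbert-Schmidt inner product. -/
def measurement {m n₁ n₂ : ℕ} (A : Fin m → Matrix (Fin n₁) (Fin n₂) ℝ) :
    Matrix (Fin n₁) (Fin n₂) ℝ →ₗ[ℝ] (Fin m → ℝ) where
  toFun X := fun i => ∑ a, ∑ b, X a b * A i a b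
  map_add' X Y := by
    ext i
    simp [add_mul, Finset.sum_add_distrib]
  map_smul' s X := by
    ext i
    simp [Finset.mul_sum, mul_assoc]

/-- The `m × m` difference matrix, with `1` on the diagonal and `-1` on the sub-diagonal. -/
def diffMatrix (m : ℕ) : Matrix (Fin m) (Fin m) ℝ :=
  Matrix.of fun i j => if i = j then 1 else if (i : ℕ) = j + 1 then -1 else 0

/-! ### Sub-Gaussian measurement operators -/

/-- The entries of the random matrices `A 0, …, A (m - 1)` are independent and identically
distributed with mean zero, unit variance, and sub-Gaussian with parameter `K`, that is
`ℙ(|ξ| > t) ≤ exp (1 - t² / K)` for all `t ≥ 0`. -/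
structure IsSubGaussianEnsemble {Ω : Type*} [MeasurableSpace Ω] (P : Measure Ω) (K : ℝ)
    {m n₁ n₂ : ℕ} (A : Ω → Fin m → Matrix (Fin n₁) (Fin n₂) ℝ) : Prop where
  measurable : ∀ i a b, Measurable fun ω => A ω i a b
  indep : iIndepFun (fun (p : Fin m × Fin n₁ × Fin n₂) ω => A ω p.1 p.2.1 p.2.2) P
  identDistrib : ∀ p q : Fin m × Fin n₁ × Fin n₂,
    IdentDistrib (fun ω => A ω p.1 p.2.1 p.2.2) (fun ω => A ω q.1 q.2.1 q.2.2) P P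
  mean_zero : ∀ i a b, ∫ ω, A ω i a b ∂P = 0
  unit_variance : ∀ i a b, variance (fun ω => A ω i a b) P = 1
  tail : ∀ i a b, ∀ t : ℝ, 0 ≤ t → P.real {ω | t < |A ω i a b|} ≤ Real.exp (1 - t ^ 2 / K)

/-! ### Sigma-Delta quantization -/

/-- The `2L`-level alphabet `{± (j - 1/2) β : j = 1, …, L}` with step-size `β`. -/
def alphabet (L : ℕ) (β : ℝ) : Set ℝ :=
  {a | ∃ j : ℕ, 1 ≤ j ∧ j ≤ L ∧ (a = ((j : ℝ) - 1 / 2) * β ∨ a = -(((j : ℝ) - 1 / 2) * β))}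

/-- An `r`-th order `ΣΔ` scheme with step-size `β`: a number of levels, a scalar quantizer that
sends every real number to a nearest element of the alphabet (ties broken arbitrarily), and the
function `rho` that combines the previous `r` state variables `u_{i-1}, …, u_{i-r}` and the current
measurement `y_i`. -/
structure Scheme (r : ℕ) (β : ℝ) where
  L : ℕ
  L_pos : 1 ≤ L
  quant : ℝ → ℝ
  quant_mem : ∀ z, quant z ∈ alphabet L β
  quant_nearest : ∀ z, ∀ v ∈ alphabet L β, |quant z - z| ≤ |v - z|
  rho : (Fin r → ℝ) → ℝ → ℝ

/-- The vector `(u_{i-1}, …, u_{i-r})`, where state variables before the first one are `0`. -/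
def past {m : ℕ} (r : ℕ) (u : Fin m → ℝ) (i : Fin m) : Fin r → ℝ := fun j =>
  if (j : ℕ) + 1 ≤ (i : ℕ) then u ⟨(i : ℕ) - ((j : ℕ) + 1), by omega⟩ else 0

/-- The output `q_i = Q_𝒜 (ρ_r (u_{i-1}, …, u_{i-r}, y_i))` for input `y` and state `u`. -/
def Scheme.outputOf {r : ℕ} {β : ℝ} (Q : Scheme r β) {m : ℕ} (y u : Fin m → ℝ) : Fin m → ℝ :=
  fun i => Q.quant (Q.rho (past r u i) (y i))

/-- `u` is the state vector for the input `y`: it solves `D ^ r u = y - q`, i.e.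
`(Δ ^ r u)_i = y_i - q_i` with `u_i = 0` for `i ≤ 0`. -/
def Scheme.IsState {r : ℕ} {β : ℝ} (Q : Scheme r β) {m : ℕ} (y u : Fin m → ℝ) : Prop :=
  (diffMatrix m ^ r).mulVec u = y - Q.outputOf y u

theorem diffMatrix_pow_apply_lt {m : ℕ} (r : ℕ) {i j : Fin m} (h : i < j) :
    (diffMatrix m ^ r) i j = 0 := by
  have hD : (diffMatrix m).BlockTriangular OrderDual.toDual := by
    intro a b hab
    have hab' : a < b := hab
    have h1 : a ≠ b := ne_of_lt hab'
    have h2 : (a : ℕ) ≠ b + 1 := by have := Fin.lt_def.1 hab'; omega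
    simp [diffMatrix, h1, h2]
  exact hD.pow r h

theorem diffMatrix_pow_apply_self {m : ℕ} (r : ℕ) (i : Fin m) : (diffMatrix m ^ r) i i = 1 := by
  induction r with
  | zero => simp
  | succ r ih =>
    rw [pow_succ, Matrix.mul_apply, Finset.sum_eq_single i]
    · rw [ih]
      simp [diffMatrix]
    · intro j _ hj
      rcases lt_or_gt_of_ne hj with h | h
      · have h1 : j ≠ i := hj
        have h2 : (j : ℕ) ≠ i + 1 := by have := Fin.lt_def.1 h; omega
        simp [diffMatrix, h1, h2]
      · rw [diffMatrix_pow_apply_lt r h, zero_mul]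
    · simp

theorem diffMatrix_pow_mulVec {m : ℕ} (r : ℕ) (u : Fin m → ℝ) (i : Fin m) :
    (diffMatrix m ^ r).mulVec u i = u i + ∑ j, if j < i then (diffMatrix m ^ r) i j * u j else 0 := by
  have h : ∀ j, (diffMatrix m ^ r) i j * u j =
      (if j = i then u i else 0) + if j < i then (diffMatrix m ^ r) i j * u j else 0 := by
    intro j
    rcases lt_trichotomy j i with h | h | h
    · simp [h, h.ne]
    · subst h
      simp [diffMatrix_pow_apply_self]
    · simp [diffMatrix_pow_apply_lt r h, h.ne', h.not_gt]
  simp only [Matrix.mulVec, dotProduct]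
  rw [Finset.sum_congr rfl fun j _ => h j, Finset.sum_add_distrib]
  simp

theorem past_congr {m r : ℕ} {u v : Fin m → ℝ} {i : Fin m} (h : ∀ j < i, u j = v j) :
    past r u i = past r v i := by
  funext j
  unfold past
  split_ifs with hj
  · apply h
    rw [Fin.lt_def]
    simp only
    omega
  · rfl

/-- The recursion determines the state variables. -/
theorem Scheme.existsUnique_isState {r : ℕ} {β : ℝ} (Q : Scheme r β) {m : ℕ} (y : Fin m → ℝ) :
    ∃! u, Q.IsState y u := by
  let F : (i : Fin m) → ((j : Fin m) → j < i → ℝ) → ℝ := fun i f =>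
    y i - Q.quant (Q.rho (past r (fun j => if h : j < i then f j h else 0) i) (y i)) -
      ∑ j, if h : j < i then (diffMatrix m ^ r) i j * f j h else 0
  have key : ∀ u : Fin m → ℝ, Q.IsState y u ↔ ∀ i, u i = F i fun j _ => u j := by
    intro u
    have hp : ∀ i, past r (fun j => if j < i then u j else 0) i = past r u i := fun i =>
      past_congr fun j hj => by simp [hj]
    unfold Scheme.IsState
    rw [funext_iff]
    refine forall_congr' fun i => ?_
    rw [diffMatrix_pow_mulVec]
    simp only [F, dite_eq_ite, hp, Scheme.outputOf, Pi.sub_apply]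
    constructor <;> intro h <;> linarith
  refine ⟨wellFounded_lt.fix F, (key _).2 fun i => wellFounded_lt.fix_eq F i, fun v hv => ?_⟩
  have hv' := (key v).1 hv
  funext i
  induction i using WellFoundedLT.induction with
  | ind i ih =>
    rw [hv' i, wellFounded_lt.fix_eq F i]
    congr 1
    funext j hj
    exact ih j hj

/-- The state variables of the scheme `Q` on the input `y`. -/
def Scheme.state {r : ℕ} {β : ℝ} (Q : Scheme r β) {m : ℕ} (y : Fin m → ℝ) : Fin m → ℝ :=
  (Q.existsUnique_isState y).choose

/-- The quantization `q = Q_{ΣΔ}^{(r)} (y)`. -/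
def Scheme.quantize {r : ℕ} {β : ℝ} (Q : Scheme r β) {m : ℕ} (y : Fin m → ℝ) : Fin m → ℝ :=
  Q.outputOf y (Q.state y)

/-- `γ` is a stability constant of the scheme: inputs of any length with `‖y‖_∞ ≤ 1` produce state
variables with `‖u‖_∞ ≤ γ`. -/
def Scheme.IsStable {r : ℕ} {β : ℝ} (Q : Scheme r β) (γ : ℝ) : Prop :=
  ∀ (m : ℕ) (y : Fin m → ℝ), (∀ i, |y i| ≤ 1) → ∀ i, |Q.state y i| ≤ γ

/-! ### The decoder -/

/-- Feasibility of `(Z, ν)`: `‖D^{-r} (M(Z) + ν - q)‖₂ ≤ γ √m` and `‖ν‖₂ ≤ ε √m`. -/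
def IsFeasible {m n₁ n₂ : ℕ} (M : Matrix (Fin n₁) (Fin n₂) ℝ →ₗ[ℝ] (Fin m → ℝ)) (r : ℕ) (γ ε : ℝ)
    (q : Fin m → ℝ) (Z : Matrix (Fin n₁) (Fin n₂) ℝ) (ν : Fin m → ℝ) : Prop :=
  l2Norm (((diffMatrix m)⁻¹ ^ r).mulVec (M Z + ν - q)) ≤ γ * √m ∧ l2Norm ν ≤ ε * √m

/-- `(X', ν')` minimizes the nuclear norm of the first component among the feasible pairs. -/
def IsDecoded {m n₁ n₂ : ℕ} (M : Matrix (Fin n₁) (Fin n₂) ℝ →ₗ[ℝ] (Fin m → ℝ)) (r : ℕ) (γ ε : ℝ)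
    (q : Fin m → ℝ) (X' : Matrix (Fin n₁) (Fin n₂) ℝ) (ν' : Fin m → ℝ) : Prop :=
  IsFeasible M r γ ε q X' ν' ∧
    ∀ Z ν, IsFeasible M r γ ε q Z ν → nuclearNorm X' ≤ nuclearNorm Z

end SigmaDelta

end

/-! The error is compared with the measurements after a linear compression `B` from `ℝ^m` to `ℝ^ℓ`
that does two things at once. Its rows are unit vectors with disjoint supports, so for a fixed
matrix `Z` the entries of `B M(Z)` are again independent, centred and sub-Gaussian, with second
moment `‖Z‖_F ^ 2`. Its rows are also sampled B-splines, so `B D^r` is very small: its operator norm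
is at most `(r + 1) (2 / w) ^ r`, where `w` is about `m / (ℓ (r + 1))` (`exists_isBlockFrame`).

The true matrix is feasible, because `D^{-r}(y - q)` is the state vector, whose entries are at most
`γ`. For a decoder output `X'` and `H = X' - X`, feasibility of both matrices gives `‖D^{-r} M(H)‖ ≤
2 γ √m`, hence `‖B M(H)‖ ≤ 2 ‖B D^r‖ γ √m`. Minimality of the nuclear norm gives `‖H‖_* ≤ 3 √k
‖H‖_F` (`nuclearNorm_le_of_descent`). For such `H` one has `‖B M(H)‖ ≥ √ℓ ‖H‖_F / 8` with high
probability (`HasLowRankBounds.le_l2Norm`). Together these bound `‖H‖_F` by `16 ‖B D^r‖ γ √λ`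
(`decoder_error_le`).

The lower bound comes from two-sided estimates on matrices of rank `R`, a large multiple of `k`:
concentration for one matrix, a union bound over nets of the two factors
(`exists_lowRank_constants`), then a decomposition of `H` into blocks of `R` singular values.

With `γ ≤ C^r r^r β`, the product `‖B D^r‖ γ` is at most `β (r + 1)` times the `r`-th power of a
constant multiple of `C r (r + 1) / λ`. Taking `r` a small multiple of `√λ` makes that base at most
`e^{-3}`, whence the decay `e^{-c₁ √λ}` (`order_error_le`). -/

noncomputable section

namespace SigmaDelta

/-! ### Nets in finite-dimensional normed spaces -/

section Nets

open Module Metric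
open scoped ENNReal

variable {E : Type*} [NormedAddCommGroup E] [NormedSpace ℝ E]

/-- The volumetric bound for separated subsets of the unit ball. -/
theorem card_le_of_separated_unitBall [FiniteDimensional ℝ E] {ε : ℝ} (hε : 0 < ε) (s : Finset E)
    (hs : ∀ c ∈ s, ‖c‖ ≤ 1) (h : ∀ c ∈ s, ∀ d ∈ s, c ≠ d → ε ≤ ‖c - d‖) :
    (s.card : ℝ) ≤ (1 + 2 / ε) ^ finrank ℝ E := by
  borelize E
  let μ : Measure E := Measure.addHaar
  have hδ : 0 < ε / 2 := by positivity
  have hρ : 0 < 1 + ε / 2 := by positivity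
  have hdisj : Set.Pairwise (s : Set E) (Function.onFun Disjoint fun c => ball (c : E) (ε / 2)) := by
    intro c hc d hd hcd
    apply ball_disjoint_ball
    rw [dist_eq_norm]
    linarith [h c hc d hd hcd]
  have hsub : (⋃ c ∈ s, ball (c : E) (ε / 2)) ⊆ ball (0 : E) (1 + ε / 2) := by
    refine Set.iUnion₂_subset fun x hx => ?_
    apply ball_subset_ball'
    rw [dist_zero_right]
    linarith [hs x hx]
  have key : (s.card : ℝ≥0∞) * ENNReal.ofReal ((ε / 2) ^ finrank ℝ E) * μ (ball 0 1) ≤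
      ENNReal.ofReal ((1 + ε / 2) ^ finrank ℝ E) * μ (ball 0 1) := by
    calc (s.card : ℝ≥0∞) * ENNReal.ofReal ((ε / 2) ^ finrank ℝ E) * μ (ball 0 1)
        = μ (⋃ c ∈ s, ball (c : E) (ε / 2)) := by
          rw [measure_biUnion_finset hdisj fun c _ => measurableSet_ball]
          simp only [μ.addHaar_ball_of_pos _ hδ, Finset.sum_const, nsmul_eq_mul, mul_assoc]
      _ ≤ μ (ball (0 : E) (1 + ε / 2)) := measure_mono hsub
      _ = _ := by simp only [μ.addHaar_ball_of_pos _ hρ]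
  have key2 := (ENNReal.mul_le_mul_iff_left (measure_ball_pos μ (0 : E) zero_lt_one).ne'
    measure_ball_lt_top.ne).1 key
  have key3 := ENNReal.toReal_le_of_le_ofReal (pow_nonneg hρ.le _) key2
  rw [ENNReal.toReal_mul, ENNReal.toReal_ofReal (by positivity), ENNReal.toReal_natCast] at key3
  have : (1 + 2 / ε) = (1 + ε / 2) / (ε / 2) := by field_simp; ring
  rw [this, div_pow, le_div_iff₀ (by positivity)]
  exact key3

/-- A separated set of the largest possible cardinality is a net: a point far from all its members
could be added. The volumetric bound is what makes a largest cardinality exist. -/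
theorem exists_unitBall_net (E : Type*) [NormedAddCommGroup E] [NormedSpace ℝ E]
    [FiniteDimensional ℝ E] {ε : ℝ} (hε : 0 < ε) :
    ∃ s : Finset E, (s.card : ℝ) ≤ (1 + 2 / ε) ^ finrank ℝ E ∧ (∀ c ∈ s, ‖c‖ ≤ 1) ∧
      ∀ x : E, ‖x‖ ≤ 1 → ∃ c ∈ s, ‖x - c‖ ≤ ε := by
  classical
  let p : ℕ → Prop := fun n => ∃ s : Finset E, s.card = n ∧ (∀ c ∈ s, ‖c‖ ≤ 1) ∧
    ∀ c ∈ s, ∀ d ∈ s, c ≠ d → ε ≤ ‖c - d‖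
  have hp0 : p 0 := ⟨∅, by simp⟩
  let b := ⌊(1 + 2 / ε) ^ finrank ℝ E⌋₊
  have hb : ∀ n, p n → n ≤ b := by
    rintro n ⟨s, rfl, h1, h2⟩
    exact Nat.le_floor (card_le_of_separated_unitBall hε s h1 h2)
  obtain ⟨s, hcard, h1, h2⟩ : p (Nat.findGreatest p b) := Nat.findGreatest_spec (Nat.zero_le b) hp0
  refine ⟨s, card_le_of_separated_unitBall hε s h1 h2, h1, fun x hx => ?_⟩
  by_contra! hcon
  have hxs : x ∉ s := fun hxs => by
    have := hcon x hxs
    simp only [sub_self, norm_zero] at this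
    linarith
  have hp : p (s.card + 1) := by
    refine ⟨insert x s, Finset.card_insert_of_notMem hxs, ?_, ?_⟩
    · intro c hc
      rcases Finset.mem_insert.1 hc with rfl | hc
      · exact hx
      · exact h1 c hc
    · intro c hc d hd hcd
      rcases Finset.mem_insert.1 hc with rfl | hc' <;>
        rcases Finset.mem_insert.1 hd with rfl | hd'
      · exact absurd rfl hcd
      · exact (hcon d hd').le
      · rw [norm_sub_rev]; exact (hcon c hc').le
      · exact h2 c hc' d hd' hcd
  have := Nat.le_findGreatest (hb _ hp) hp
  omega

variable {F G : Type*} [NormedAddCommGroup F] [NormedSpace ℝ F]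
  [NormedAddCommGroup G] [NormedSpace ℝ G]

/-- A vector is controlled by its inner products with a net of the unit ball. -/
theorem norm_le_of_net {V : Type*} [NormedAddCommGroup V] [InnerProductSpace ℝ V]
    {s : Set V} (hs : ∀ x : V, ‖x‖ ≤ 1 → ∃ c ∈ s, ‖x - c‖ ≤ 1 / 2) {M : ℝ} {x : V}
    (hM : ∀ c ∈ s, inner ℝ c x ≤ M) : ‖x‖ ≤ 2 * M := by
  by_cases hx : x = 0
  · subst hx
    obtain ⟨c, hc, -⟩ := hs 0 (by simp)
    have := hM c hc
    simp only [inner_zero_right, norm_zero] at this ⊢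
    linarith
  have hx0 : 0 < ‖x‖ := norm_pos_iff.2 hx
  obtain ⟨c, hc, hxc⟩ := hs (‖x‖⁻¹ • x) (by rw [norm_smul, norm_inv, norm_norm]; field_simp; simp)
  have h1 := hM c hc
  have h2 : inner ℝ (‖x‖⁻¹ • x - c) x ≤ 1 / 2 * ‖x‖ :=
    (real_inner_le_norm _ _).trans (by gcongr)
  rw [inner_sub_left, inner_smul_left, real_inner_self_eq_norm_sq] at h2
  simp only [conj_trivial] at h2
  have : ‖x‖⁻¹ * ‖x‖ ^ 2 = ‖x‖ := by field_simp
  linarith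

/-- A bilinear map is controlled by its values on nets of the unit balls. -/
theorem bilinear_le_of_net [FiniteDimensional ℝ E] [FiniteDimensional ℝ F]
    (Ψ : E →ₗ[ℝ] F →ₗ[ℝ] G) {s : Set E} {t : Set F} {ε M : ℝ}
    (hε : ε ≤ 1 / 4)
    (hs1 : ∀ x ∈ s, ‖x‖ ≤ 1) (hs : ∀ x : E, ‖x‖ ≤ 1 → ∃ c ∈ s, ‖x - c‖ ≤ ε)
    (ht : ∀ x : F, ‖x‖ ≤ 1 → ∃ c ∈ t, ‖x - c‖ ≤ ε)
    (hM : ∀ x ∈ s, ∀ y ∈ t, ‖Ψ x y‖ ≤ M) (x : E) (y : F) : ‖Ψ x y‖ ≤ 2 * M * ‖x‖ * ‖y‖ := by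
  -- Finite dimension makes the bilinear map bounded, so `‖Φ‖` is a finite number. Replacing both
  -- arguments by net points costs `‖Φ‖ / 4` twice, and `‖Φ‖ ≤ M + ‖Φ‖ / 2` can be solved for `‖Φ‖`.
  let Φ : E →L[ℝ] F →L[ℝ] G := LinearMap.toContinuousLinearMap
    ((LinearMap.toContinuousLinearMap (𝕜 := ℝ) (E := F) (F' := G)).toLinearMap ∘ₗ Ψ)
  change ∀ x ∈ s, ∀ y ∈ t, ‖Φ x y‖ ≤ M at hM
  change ‖Φ x y‖ ≤ _
  have hε0 : 0 ≤ ε := by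
    obtain ⟨c, _, hc⟩ := hs 0 (by simp)
    exact (norm_nonneg _).trans hc
  have unit : ∀ x y, ‖x‖ ≤ 1 → ‖y‖ ≤ 1 → ‖Φ x y‖ ≤ M + 1 / 2 * ‖Φ‖ := by
    intro x y hx hy
    obtain ⟨x', hx', hxx⟩ := hs x hx
    obtain ⟨y', hy', hyy⟩ := ht y hy
    have e : Φ x y = Φ x' y' + Φ (x - x') y + Φ x' (y - y') := by
      simp only [map_sub, sub_apply]; abel
    have b1 : ‖Φ (x - x') y‖ ≤ ‖Φ‖ * (1 / 4) * 1 :=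
      (Φ.le_opNorm₂ _ _).trans (by gcongr; exact hxx.trans hε)
    have b2 : ‖Φ x' (y - y')‖ ≤ ‖Φ‖ * 1 * (1 / 4) :=
      (Φ.le_opNorm₂ _ _).trans (by gcongr; exacts [hs1 x' hx', hyy.trans hε])
    rw [e]
    linarith [norm_add₃_le (a := Φ x' y') (b := Φ (x - x') y) (c := Φ x' (y - y')),
      hM x' hx' y' hy']
  have hM0 : 0 ≤ M + 1 / 2 * ‖Φ‖ := by simpa using unit 0 0 (by simp) (by simp)
  have hΦ : ‖Φ‖ ≤ M + 1 / 2 * ‖Φ‖ := by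
    refine Φ.opNorm_le_bound₂ hM0 fun x y => ?_
    by_cases hx : x = 0
    · simp [hx]
    by_cases hy : y = 0
    · simp [hy]
    have hx0 : 0 < ‖x‖ := norm_pos_iff.2 hx
    have hy0 : 0 < ‖y‖ := norm_pos_iff.2 hy
    have := unit (‖x‖⁻¹ • x) (‖y‖⁻¹ • y) (by rw [norm_smul, norm_inv, norm_norm]; field_simp; simp)
      (by rw [norm_smul, norm_inv, norm_norm]; field_simp; simp)
    simp only [map_smul, smul_apply, norm_smul, norm_inv, norm_norm] at this
    field_simp at this
    linarith
  have := Φ.le_opNorm₂ x y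
  have h2 : ‖Φ‖ ≤ 2 * M := by linarith
  calc ‖Φ x y‖ ≤ ‖Φ‖ * ‖x‖ * ‖y‖ := this
    _ ≤ _ := by gcongr

end Nets

/-! ### Sub-Gaussian random variables -/

section SubGaussian

open scoped ENNReal NNReal

variable {Ω : Type*} [MeasurableSpace Ω] {P : Measure Ω}

/-- The tail bound controls the exponential moment of the square. -/
theorem lintegral_exp_sq_le [IsProbabilityMeasure P] {K : ℝ} (hK : 0 < K) {ξ : Ω → ℝ}
    (hm : Measurable ξ)
    (htail : ∀ t : ℝ, 0 ≤ t → P.real {ω | t < |ξ ω|} ≤ Real.exp (1 - t ^ 2 / K)) :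
    ∫⁻ ω, ENNReal.ofReal (Real.exp (ξ ω ^ 2 / (2 * K))) ∂P ≤ ENNReal.ofReal 4 := by
  have hmeas : Measurable fun ω => Real.exp (ξ ω ^ 2 / (2 * K)) := by fun_prop
  rw [lintegral_eq_lintegral_meas_lt P (Filter.Eventually.of_forall fun ω => (Real.exp_pos _).le)
    hmeas.aemeasurable]
  -- In the layer-cake integral, levels `t ≤ 1` contribute at most `1`. For `t > 1` the tail bound
  -- at `√(2 K log t)` equals `e t^{-2}`, with integral `e`; and `1 + e ≤ 4`.
  rw [← Set.Ioc_union_Ioi_eq_Ioi zero_le_one, lintegral_union measurableSet_Ioi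
    (Set.Ioc_disjoint_Ioi le_rfl)]
  have h1 : ∫⁻ t in Set.Ioc (0 : ℝ) 1, P {a | t < Real.exp (ξ a ^ 2 / (2 * K))} ≤ 1 := by
    calc _ ≤ ∫⁻ t in Set.Ioc (0 : ℝ) 1, 1 := lintegral_mono fun t => prob_le_one
      _ = 1 := by simp
  have hint : IntegrableOn (fun t : ℝ => Real.exp 1 * t ^ (-2 : ℝ)) (Set.Ioi 1) :=
    (integrableOn_Ioi_rpow_of_lt (by norm_num) one_pos).const_mul _
  have h2 : ∫⁻ t in Set.Ioi (1 : ℝ), P {a | t < Real.exp (ξ a ^ 2 / (2 * K))} ≤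
      ENNReal.ofReal (Real.exp 1) := by
    calc _ ≤ ∫⁻ t in Set.Ioi (1 : ℝ), ENNReal.ofReal (Real.exp 1 * t ^ (-2 : ℝ)) := by
          refine setLIntegral_mono (by fun_prop) fun t ht => ?_
          have ht1 : 1 < t := ht
          have ht0 : 0 < t := by linarith
          have hlog : 0 ≤ Real.log t := Real.log_nonneg ht1.le
          have hsub : {a | t < Real.exp (ξ a ^ 2 / (2 * K))} ⊆
              {ω | √(2 * K * Real.log t) < |ξ ω|} := by
            intro a ha
            simp only [Set.mem_ofPred_eq] at ha ⊢
            have := (Real.log_lt_iff_lt_exp ht0).2 ha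
            rw [lt_div_iff₀ (by positivity)] at this
            rw [← Real.sqrt_sq_eq_abs]
            exact Real.sqrt_lt_sqrt (by positivity) (by linarith)
          refine (measure_mono hsub).trans ?_
          rw [← ofReal_measureReal]
          refine ENNReal.ofReal_le_ofReal ((htail _ (Real.sqrt_nonneg _)).trans (le_of_eq ?_))
          rw [Real.sq_sqrt (by positivity), Real.rpow_def_of_pos ht0, ← Real.exp_add]
          congr 1
          field_simp
          ring
      _ = ENNReal.ofReal (∫ t in Set.Ioi (1 : ℝ), Real.exp 1 * t ^ (-2 : ℝ)) := by
          rw [ofReal_integral_eq_lintegral_ofReal hint]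
          filter_upwards [ae_restrict_mem measurableSet_Ioi] with t ht
          have : (0 : ℝ) < t := lt_trans one_pos ht
          simp only [Pi.zero_apply]
          positivity
      _ = ENNReal.ofReal (Real.exp 1) := by
          rw [integral_const_mul, integral_Ioi_rpow_of_lt (by norm_num) one_pos]
          norm_num
  refine (add_le_add h1 h2).trans ?_
  rw [← ENNReal.ofReal_one, ← ENNReal.ofReal_add zero_le_one (Real.exp_pos _).le]
  exact ENNReal.ofReal_le_ofReal (by linarith [Real.exp_one_lt_d9])

/-- A second-order Taylor bound that keeps the linear term exact, so that this term vanishes on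
integrating a centred variable. -/
theorem exp_le_one_add_add_sq_mul_exp_abs (x : ℝ) :
    Real.exp x ≤ 1 + x + x ^ 2 * Real.exp |x| := by
  have h := Complex.norm_exp_sub_sum_le_norm_mul_exp x 2
  simp only [Finset.sum_range_succ, Finset.sum_range_zero, Nat.factorial] at h
  have e : Complex.exp x - (0 + (x : ℂ) ^ 0 / ((1 : ℕ) : ℂ) + (x : ℂ) ^ 1 / ((((0 + 1) * 1 : ℕ) : ℕ) : ℂ)) =
      ((Real.exp x - 1 - x : ℝ) : ℂ) := by
    push_cast; ring
  rw [e, Complex.norm_real, Complex.norm_real, Real.norm_eq_abs, Real.norm_eq_abs, sq_abs] at h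
  linarith [(abs_le.1 h).2]

/-- A centred random variable with a sub-Gaussian tail has a sub-Gaussian moment generating
function. -/
theorem hasSubgaussianMGF_of_tail [IsProbabilityMeasure P] {K : ℝ} (hK : 0 < K) {ξ : Ω → ℝ}
    (hm : Measurable ξ) (hmean : ∫ ω, ξ ω ∂P = 0)
    (htail : ∀ t : ℝ, 0 ≤ t → P.real {ω | t < |ξ ω|} ≤ Real.exp (1 - t ^ 2 / K)) :
    HasSubgaussianMGF ξ (34 * K).toNNReal P := by
  have hlint := lintegral_exp_sq_le hK hm htail
  have hmeas : Measurable fun ω => Real.exp (ξ ω ^ 2 / (2 * K)) := by fun_prop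
  have hpos : 0 ≤ᵐ[P] fun ω => Real.exp (ξ ω ^ 2 / (2 * K)) :=
    Filter.Eventually.of_forall fun ω => (Real.exp_pos _).le
  have hint : Integrable (fun ω => Real.exp (ξ ω ^ 2 / (2 * K))) P := by
    refine ⟨hmeas.aestronglyMeasurable, ?_⟩
    rw [hasFiniteIntegral_iff_ofReal hpos]
    exact hlint.trans_lt ENNReal.ofReal_lt_top
  have hE : ∫ ω, Real.exp (ξ ω ^ 2 / (2 * K)) ∂P ≤ 4 := by
    rw [← ofReal_integral_eq_lintegral_ofReal hint hpos] at hlint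
    exact (ENNReal.ofReal_le_ofReal_iff (by norm_num)).1 hlint
  -- The weight `4 K` is chosen so that `exp |s x|` and `x ^ 2` each cost one factor `exp (x ^ 2 /
  -- (4 K))`. Their product is exactly the integrable `exp (x ^ 2 / (2 K))`.
  have young : ∀ s x : ℝ, |s * x| ≤ K * s ^ 2 + x ^ 2 / (4 * K) := by
    intro s x
    have h : x ^ 2 / (4 * K) = K * (x / (2 * K)) ^ 2 := by field_simp; ring
    have h2 : s * x = 2 * K * (s * (x / (2 * K))) := by field_simp
    rw [h, h2, abs_le]
    constructor <;> nlinarith [sq_nonneg (s + x / (2 * K)), sq_nonneg (s - x / (2 * K)), hK]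
  have hexp : ∀ s x : ℝ, Real.exp |s * x| ≤ Real.exp (K * s ^ 2) * Real.exp (x ^ 2 / (4 * K)) := by
    intro s x
    rw [← Real.exp_add]
    exact Real.exp_le_exp.2 (young s x)
  have hhalf : ∀ x : ℝ, Real.exp (x ^ 2 / (2 * K)) =
      Real.exp (x ^ 2 / (4 * K)) * Real.exp (x ^ 2 / (4 * K)) := by
    intro x
    rw [← Real.exp_add]
    congr 1
    field_simp
    ring
  have hintexp : ∀ t : ℝ, Integrable (fun ω => Real.exp (t * ξ ω)) P := by
    intro t
    refine (hint.const_mul (Real.exp (K * t ^ 2))).mono' (by fun_prop)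
      (Filter.Eventually.of_forall fun ω => ?_)
    rw [Real.norm_eq_abs, abs_of_pos (Real.exp_pos _)]
    refine (Real.exp_le_exp.2 (le_abs_self _)).trans ((hexp t (ξ ω)).trans ?_)
    rw [hhalf]
    gcongr
    exact le_mul_of_one_le_left (Real.exp_pos _).le (Real.one_le_exp (by positivity))
  have hξint : Integrable ξ P := by
    refine (hint.const_mul (4 * K + 1)).mono' hm.aestronglyMeasurable
      (Filter.Eventually.of_forall fun ω => ?_)
    have h1 := Real.add_one_le_exp (ξ ω ^ 2 / (2 * K))
    have h2 : ξ ω ^ 2 = 2 * K * (ξ ω ^ 2 / (2 * K)) := by field_simp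
    have h3 : 0 ≤ ξ ω ^ 2 / (2 * K) := by positivity
    rw [Real.norm_eq_abs]
    nlinarith [sq_abs (ξ ω), sq_nonneg (|ξ ω| - 1)]
  refine ⟨hintexp, fun s => ?_⟩
  have hpt : ∀ x : ℝ, Real.exp (s * x) ≤
      1 + s * x + 4 * K * s ^ 2 * Real.exp (K * s ^ 2) * Real.exp (x ^ 2 / (2 * K)) := by
    intro x
    refine (exp_le_one_add_add_sq_mul_exp_abs _).trans ?_
    have h1 : x ^ 2 ≤ 4 * K * Real.exp (x ^ 2 / (4 * K)) := by
      have := Real.add_one_le_exp (x ^ 2 / (4 * K))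
      have h2 : x ^ 2 = 4 * K * (x ^ 2 / (4 * K)) := by field_simp
      calc x ^ 2 = 4 * K * (x ^ 2 / (4 * K)) := h2
        _ ≤ _ := by gcongr; linarith
    have : (s * x) ^ 2 * Real.exp |s * x| ≤ s ^ 2 * (4 * K * Real.exp (x ^ 2 / (4 * K))) *
        (Real.exp (K * s ^ 2) * Real.exp (x ^ 2 / (4 * K))) := by
      rw [mul_pow]
      gcongr
      exact hexp s x
    rw [hhalf]
    linarith
  have hbound : mgf ξ P s ≤ 1 + 4 * K * s ^ 2 * Real.exp (K * s ^ 2) * 4 := by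
    unfold mgf
    have hi1 : Integrable (fun ω => 1 + s * ξ ω) P := (integrable_const _).add (hξint.const_mul s)
    have hi2 := hint.const_mul (4 * K * s ^ 2 * Real.exp (K * s ^ 2))
    calc ∫ ω, Real.exp (s * ξ ω) ∂P ≤ ∫ ω, (1 + s * ξ ω +
          4 * K * s ^ 2 * Real.exp (K * s ^ 2) * Real.exp (ξ ω ^ 2 / (2 * K))) ∂P :=
          integral_mono (hintexp s) (hi1.add hi2) fun ω => hpt (ξ ω)
      _ = 1 + 4 * K * s ^ 2 * Real.exp (K * s ^ 2) * ∫ ω, Real.exp (ξ ω ^ 2 / (2 * K)) ∂P := by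
          rw [integral_add hi1 hi2, integral_const_mul,
            integral_add (integrable_const _) (hξint.const_mul s), integral_const_mul, hmean]
          simp
      _ ≤ _ := by gcongr
  refine hbound.trans ?_
  -- The bound `1 + 16 K s² e^{K s²}` is at most `e^{K s²} (1 + 16 K s²) ≤ e^{17 K s²}`, which
  -- corresponds to the variance proxy `34 K`.
  have hc : ((34 * K).toNNReal : ℝ) * s ^ 2 / 2 = K * s ^ 2 + 16 * K * s ^ 2 := by
    rw [Real.coe_toNNReal _ (by positivity)]; ring
  rw [hc, Real.exp_add]
  have h1 : 1 ≤ Real.exp (K * s ^ 2) := Real.one_le_exp (by positivity)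
  have h2 := Real.add_one_le_exp (16 * K * s ^ 2)
  calc 1 + 4 * K * s ^ 2 * Real.exp (K * s ^ 2) * 4
      ≤ Real.exp (K * s ^ 2) * (16 * K * s ^ 2 + 1) := by linarith
    _ ≤ _ := by gcongr

/-- Expanding the exponential gives `x ^ 4 / 24 ≤ e^{|x|} ≤ e^x + e^{-x}`, and the moment generating
function at `1` and `-1` is at most `e^{c / 2}`. -/
theorem integral_pow_four_le [IsProbabilityMeasure P] {X : Ω → ℝ} {c : ℝ≥0}
    (hX : HasSubgaussianMGF X c P) :
    Integrable (fun ω => X ω ^ 4) P ∧ ∫ ω, X ω ^ 4 ∂P ≤ 48 * Real.exp (c / 2) := by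
  have hpt : ∀ x : ℝ, x ^ 4 ≤ 24 * (Real.exp (1 * x) + Real.exp (-1 * x)) := by
    intro x
    have h := Real.pow_div_factorial_le_exp |x| (abs_nonneg x) 4
    have h4 : |x| ^ 4 = x ^ 4 := by rw [← abs_pow, abs_of_nonneg (by positivity)]
    rw [h4] at h
    norm_num [Nat.factorial] at h
    have : Real.exp |x| ≤ Real.exp (1 * x) + Real.exp (-1 * x) := by
      rcases abs_cases x with ⟨h, _⟩ | ⟨h, _⟩ <;> rw [h]
      · simpa using (Real.exp_pos _).le
      · simpa using (Real.exp_pos _).le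
    linarith
  have hi := ((hX.integrable_exp_mul 1).add (hX.integrable_exp_mul (-1))).const_mul 24
  have hXm := hX.aestronglyMeasurable
  have h4 : Integrable (fun ω => X ω ^ 4) P := by
    refine hi.mono' (by fun_prop) (Filter.Eventually.of_forall fun ω => ?_)
    rw [Real.norm_eq_abs, abs_of_nonneg (by positivity)]
    exact hpt _
  refine ⟨h4, (integral_mono h4 hi fun ω => hpt (X ω)).trans ?_⟩
  have h1 := hX.mgf_le 1
  have h2 := hX.mgf_le (-1)
  simp only [Pi.add_apply]
  rw [integral_const_mul, integral_add (hX.integrable_exp_mul 1) (hX.integrable_exp_mul (-1))]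
  simp only [mgf] at h1 h2
  norm_num at h1 h2 ⊢
  linarith

/-- The lower tail of a sum of squares of independent sub-Gaussian random variables with unit
second moment. -/
theorem measure_sum_sq_le {ι : Type*} [Fintype ι] [IsProbabilityMeasure P] {Y : ι → Ω → ℝ}
    {c : ℝ≥0} (hind : iIndepFun Y P) (hm : ∀ i, Measurable (Y i))
    (hY : ∀ i, HasSubgaussianMGF (Y i) c P) (hvar : ∀ i, ∫ ω, Y i ω ^ 2 ∂P = 1) :
    P.real {ω | ∑ i, Y i ω ^ 2 ≤ Fintype.card ι / 2} ≤
      Real.exp (-(Fintype.card ι / (768 * Real.exp (c / 2)))) := by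
  set M : ℝ := 48 * Real.exp (c / 2) with hM
  have hMpos : 0 < M := by positivity
  -- This minimizes the Chernoff exponent `s / 2 - s + s² M` per variable; the minimum is `-1 / (16
  -- M)`.
  set s : ℝ := 1 / (4 * M) with hs
  have hspos : 0 < s := by positivity
  have hmgf : ∀ i, mgf (fun ω => Y i ω ^ 2) P (-s) ≤ Real.exp (-s + s ^ 2 * M) := by
    intro i
    obtain ⟨h4, h4le⟩ := integral_pow_four_le (hY i)
    have h2 : Integrable (fun ω => Y i ω ^ 2) P := by
      refine (h4.add (integrable_const 1)).mono' (by have := hm i; fun_prop)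
        (Filter.Eventually.of_forall fun ω => ?_)
      rw [Real.norm_eq_abs, abs_of_nonneg (by positivity)]
      simp only [Pi.add_apply]
      nlinarith [sq_nonneg (Y i ω ^ 2 - 1), sq_nonneg (Y i ω)]
    -- For a lower tail the exponential has a nonpositive argument, where a quadratic bound holds
    -- globally. Hence a fourth moment of `Y i` suffices.
    have hpt : ∀ y : ℝ, 0 ≤ y → Real.exp (-y) ≤ 1 - y + y ^ 2 := by
      intro y hy
      rcases le_total y 1 with h | h
      · have := Real.abs_exp_sub_one_sub_id_le (x := -y) (by rwa [abs_neg, abs_of_nonneg hy])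
        have := (abs_le.1 this).2
        nlinarith
      · have : Real.exp (-y) ≤ 1 := Real.exp_le_one_iff.2 (by linarith)
        nlinarith
    have hi1 : Integrable (fun ω => 1 - s * Y i ω ^ 2) P := (integrable_const _).sub (h2.const_mul s)
    have hi2 := h4.const_mul (s ^ 2)
    have hlhs : Integrable (fun ω => Real.exp (-s * Y i ω ^ 2)) P := by
      refine (integrable_const (1 : ℝ)).mono' (by have := hm i; fun_prop)
        (Filter.Eventually.of_forall fun ω => ?_)
      rw [Real.norm_eq_abs, abs_of_pos (Real.exp_pos _), Real.exp_le_one_iff]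
      nlinarith [sq_nonneg (Y i ω)]
    calc mgf (fun ω => Y i ω ^ 2) P (-s)
        ≤ ∫ ω, ((1 - s * Y i ω ^ 2) + s ^ 2 * Y i ω ^ 4) ∂P := by
          refine integral_mono hlhs (hi1.add hi2) fun ω => ?_
          have := hpt (s * Y i ω ^ 2) (by positivity)
          simp only
          calc Real.exp (-s * Y i ω ^ 2) = Real.exp (-(s * Y i ω ^ 2)) := by ring_nf
            _ ≤ _ := this
            _ = _ := by ring
      _ = 1 - s + s ^ 2 * ∫ ω, Y i ω ^ 4 ∂P := by
          rw [integral_add hi1 hi2, integral_const_mul,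
            integral_sub (integrable_const _) (h2.const_mul s), integral_const_mul, hvar i]
          simp
      _ ≤ (-s + s ^ 2 * M) + 1 := by nlinarith [sq_nonneg s]
      _ ≤ _ := Real.add_one_le_exp _
  have hind2 : iIndepFun (fun i ω => Y i ω ^ 2) P :=
    hind.comp (fun _ x => x ^ 2) fun _ => by fun_prop
  have hsum : (fun ω => ∑ i, Y i ω ^ 2) = ∑ i, fun ω => Y i ω ^ 2 := by
    ext ω; simp
  have hprod : mgf (fun ω => ∑ i, Y i ω ^ 2) P (-s) ≤
      Real.exp (-s + s ^ 2 * M) ^ Fintype.card ι := by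
    rw [hsum, hind2.mgf_sum (fun i => by have := hm i; fun_prop) Finset.univ]
    calc _ ≤ ∏ _i : ι, Real.exp (-s + s ^ 2 * M) :=
          Finset.prod_le_prod (fun i _ => mgf_nonneg) fun i _ => hmgf i
      _ = _ := by simp
  have hch := measure_le_le_exp_mul_mgf (μ := P) (X := fun ω => ∑ i, Y i ω ^ 2)
    ((Fintype.card ι : ℝ) / 2) (neg_nonpos.2 hspos.le) (by
      refine (integrable_const (1 : ℝ)).mono' (by fun_prop)
        (Filter.Eventually.of_forall fun ω => ?_)
      rw [Real.norm_eq_abs, abs_of_pos (Real.exp_pos _), Real.exp_le_one_iff]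
      have : 0 ≤ ∑ i, Y i ω ^ 2 := Finset.sum_nonneg fun _ _ => sq_nonneg _
      nlinarith)
  refine hch.trans ((mul_le_mul_of_nonneg_left hprod (Real.exp_pos _).le).trans (le_of_eq ?_))
  rw [← Real.exp_nat_mul, ← Real.exp_add]
  congr 1
  have : 768 * Real.exp (c / 2) = 16 * M := by rw [hM]; ring
  rw [this, hs]
  field_simp
  ring

/-- Sums over disjoint blocks of an independent family are independent. -/
theorem iIndepFun_blockSum {ι κ : Type*} [Fintype ι] [DecidableEq κ] {ξ : ι → Ω → ℝ}
    (hind : iIndepFun ξ P) (hm : ∀ i, Measurable (ξ i)) (b : ι → κ) (a : ι → ℝ) :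
    iIndepFun (fun j ω => ∑ p with b p = j, a p * ξ p ω) P := by
  classical
  have := hind.isProbabilityMeasure
  rw [iIndepFun_iff_measure_inter_preimage_eq_mul]
  intro S sets hsets
  induction S using Finset.induction_on with
  | empty => simp
  | insert j S hj ih =>
    rw [Finset.prod_insert hj, ← ih fun i hi => hsets i (Finset.mem_insert_of_mem hi)]
    -- The new block and all earlier blocks involve disjoint index sets, so one application of
    -- independence of two finite subfamilies splits off a factor.
    let T₁ : Finset ι := {p | b p = j}
    let T₂ : Finset ι := {p | b p ∈ S}
    have hdisj : Disjoint T₁ T₂ := by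
      rw [Finset.disjoint_filter]
      rintro p - rfl
      exact hj
    have hI := hind.indepFun_finset T₁ T₂ hdisj hm
    let g : κ → (T₂ → ℝ) → ℝ := fun i x =>
      ∑ p with b p = i, if h : p ∈ T₂ then a p * x ⟨p, h⟩ else 0
    have hg : ∀ i, Measurable (g i) := by
      intro i
      refine Finset.measurable_sum _ fun p _ => ?_
      split_ifs <;> fun_prop
    have hB₁ : MeasurableSet {x : T₁ → ℝ | ∑ p : T₁, a p * x p ∈ sets j} :=
      (hsets j (Finset.mem_insert_self _ _)).preimage
        (Finset.measurable_sum _ fun p _ => by fun_prop)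
    have hB₂ : MeasurableSet (⋂ i ∈ S, g i ⁻¹' sets i) :=
      Finset.measurableSet_biInter _ fun i hi => (hg i) (hsets i (Finset.mem_insert_of_mem hi))
    have h := hI.measure_inter_preimage_eq_mul _ _ hB₁ hB₂
    have e₁ : (fun (ω : Ω) (i : T₁) => ξ i ω) ⁻¹' {x : T₁ → ℝ | ∑ p : T₁, a p * x p ∈ sets j} =
        (fun ω => ∑ p with b p = j, a p * ξ p ω) ⁻¹' sets j := by
      ext ω
      simp only [Set.mem_preimage, Set.mem_ofPred_eq]
      rw [Finset.sum_coe_sort T₁ fun p => a p * ξ p ω]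
    have e₂ : (fun (ω : Ω) (i : T₂) => ξ i ω) ⁻¹' (⋂ i ∈ S, g i ⁻¹' sets i) =
        ⋂ i ∈ S, (fun ω => ∑ p with b p = i, a p * ξ p ω) ⁻¹' sets i := by
      ext ω
      simp only [Set.mem_preimage, Set.mem_iInter, g]
      refine forall₂_congr fun i hi => ?_
      rw [Finset.sum_congr rfl fun p hp => ?_]
      have : p ∈ T₂ := by
        simp only [T₂, Finset.mem_filter, Finset.mem_univ, true_and] at hp ⊢
        rwa [hp]
      simp [this]
    rw [e₁, e₂] at h
    rw [← h, Finset.set_biInter_insert]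

end SubGaussian

/-! ### The Euclidean and Frobenius norms -/

section Norms

variable {m n₁ n₂ : ℕ}

theorem l2Norm_eq_norm (v : Fin m → ℝ) : l2Norm v = ‖WithLp.toLp 2 v‖ := by
  simp [l2Norm, EuclideanSpace.norm_eq]

theorem l2Norm_nonneg (v : Fin m → ℝ) : 0 ≤ l2Norm v := Real.sqrt_nonneg _

theorem l2Norm_sq (v : Fin m → ℝ) : l2Norm v ^ 2 = ∑ i, v i ^ 2 :=
  Real.sq_sqrt (Finset.sum_nonneg fun _ _ => sq_nonneg _)

theorem l2Norm_sub_le (v w : Fin m → ℝ) : l2Norm (v - w) ≤ l2Norm v + l2Norm w := by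
  simp only [l2Norm_eq_norm, WithLp.toLp_sub]
  exact norm_sub_le _ _

theorem l2Norm_sum_le {ι : Type*} (s : Finset ι) (v : ι → Fin m → ℝ) :
    l2Norm (∑ i ∈ s, v i) ≤ ∑ i ∈ s, l2Norm (v i) := by
  simp only [l2Norm_eq_norm, WithLp.toLp_sum]
  exact norm_sum_le _ _

/-- The entries of a matrix as a Euclidean vector. -/
def entries : Matrix (Fin n₁) (Fin n₂) ℝ →ₗ[ℝ] EuclideanSpace ℝ (Fin n₁ × Fin n₂) where
  toFun X := WithLp.toLp 2 fun p => X p.1 p.2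
  map_add' _ _ := rfl
  map_smul' _ _ := rfl

theorem frobNorm_eq_norm (X : Matrix (Fin n₁) (Fin n₂) ℝ) : frobNorm X = ‖entries X‖ := by
  simp only [frobNorm, EuclideanSpace.norm_eq, Fintype.sum_prod_type, Real.norm_eq_abs, sq_abs]
  rfl

theorem frobNorm_nonneg (X : Matrix (Fin n₁) (Fin n₂) ℝ) : 0 ≤ frobNorm X := Real.sqrt_nonneg _

theorem frobNorm_sq (X : Matrix (Fin n₁) (Fin n₂) ℝ) :
    frobNorm X ^ 2 = ∑ a, ∑ b, X a b ^ 2 :=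
  Real.sq_sqrt (Finset.sum_nonneg fun _ _ => Finset.sum_nonneg fun _ _ => sq_nonneg _)

theorem frobNorm_add_le (X Y : Matrix (Fin n₁) (Fin n₂) ℝ) :
    frobNorm (X + Y) ≤ frobNorm X + frobNorm Y := by
  simp only [frobNorm_eq_norm, map_add]
  exact norm_add_le _ _

theorem frobNorm_sum_le {ι : Type*} (s : Finset ι) (X : ι → Matrix (Fin n₁) (Fin n₂) ℝ) :
    frobNorm (∑ i ∈ s, X i) ≤ ∑ i ∈ s, frobNorm (X i) := by
  simp only [frobNorm_eq_norm, map_sum]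
  exact norm_sum_le _ _

theorem frobNorm_smul (s : ℝ) (X : Matrix (Fin n₁) (Fin n₂) ℝ) :
    frobNorm (s • X) = |s| * frobNorm X := by
  simp only [frobNorm_eq_norm, map_smul, norm_smul, Real.norm_eq_abs]

end Norms

/-! ### Concentration for a fixed matrix -/

section Ensemble

open scoped NNReal

variable {Ω : Type*} [MeasurableSpace Ω] {P : Measure Ω} {K : ℝ} {m n₁ n₂ : ℕ}
  {A : Ω → Fin m → Matrix (Fin n₁) (Fin n₂) ℝ}

namespace IsSubGaussianEnsemble

theorem hasSubgaussianMGF [IsProbabilityMeasure P] (hK : 0 < K) (h : IsSubGaussianEnsemble P K A)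
    (p : Fin m × Fin n₁ × Fin n₂) :
    HasSubgaussianMGF (fun ω => A ω p.1 p.2.1 p.2.2) (34 * K).toNNReal P :=
  hasSubgaussianMGF_of_tail hK (h.measurable _ _ _) (h.mean_zero _ _ _) (h.tail _ _ _)

/-- Variance proxies of independent summands add with weights `a p ^ 2`, so a unit coefficient
vector costs nothing. -/
theorem hasSubgaussianMGF_linComb [IsProbabilityMeasure P] (hK : 0 < K)
    (h : IsSubGaussianEnsemble P K A) (a : Fin m × Fin n₁ × Fin n₂ → ℝ) (ha : ∑ p, a p ^ 2 ≤ 1) :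
    HasSubgaussianMGF (fun ω => ∑ p, a p * A ω p.1 p.2.1 p.2.2) (34 * K).toNNReal P := by
  have hind := h.indep.comp (fun p x => a p * x) fun p => by fun_prop
  have hs := HasSubgaussianMGF.sum_of_iIndepFun hind (s := Finset.univ)
    fun p _ => (h.hasSubgaussianMGF hK p).const_mul (a p)
  refine ⟨hs.integrable_exp_mul, fun t => (hs.mgf_le t).trans (Real.exp_le_exp.2 ?_)⟩
  have hK' : 0 ≤ ((34 * K).toNNReal : ℝ) * t ^ 2 / 2 := by positivity
  rw [NNReal.coe_sum]
  calc _ = (∑ p, a p ^ 2) * (((34 * K).toNNReal : ℝ) * t ^ 2 / 2) := by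
        rw [Finset.sum_mul, Finset.sum_mul, Finset.sum_div]
        refine Finset.sum_congr rfl fun p _ => ?_
        change a p ^ 2 * ((34 * K).toNNReal : ℝ) * t ^ 2 / 2 = _
        ring
    _ ≤ 1 * (((34 * K).toNNReal : ℝ) * t ^ 2 / 2) := by gcongr
    _ = _ := one_mul _

theorem integral_linComb_sq [IsProbabilityMeasure P] (hK : 0 < K)
    (h : IsSubGaussianEnsemble P K A) (a : Fin m × Fin n₁ × Fin n₂ → ℝ) :
    ∫ ω, (∑ p, a p * A ω p.1 p.2.1 p.2.2) ^ 2 ∂P = ∑ p, a p ^ 2 := by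
  have hind := h.indep.comp (fun p x => a p * x) fun p => by fun_prop
  have hL : ∀ p : Fin m × Fin n₁ × Fin n₂, MemLp (fun ω => A ω p.1 p.2.1 p.2.2) 2 P := fun p => by
    simpa using (h.hasSubgaussianMGF hK p).memLp 2
  have hv := IndepFun.variance_sum (μ := P) (s := Finset.univ)
    (X := fun p ω => a p * A ω p.1 p.2.1 p.2.2) (fun p _ => (hL p).const_mul (a p))
    fun p _ q _ hpq => hind.indepFun hpq
  have hsum : (∑ p, fun ω => a p * A ω p.1 p.2.1 p.2.2) =
      fun ω => ∑ p, a p * A ω p.1 p.2.1 p.2.2 := by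
    ext ω; simp
  rw [hsum, variance_of_integral_eq_zero] at hv
  · rw [hv]
    refine Finset.sum_congr rfl fun p _ => ?_
    rw [variance_const_mul, h.unit_variance, mul_one]
  · have := h.measurable
    exact (Finset.measurable_sum _ fun p _ => (this _ _ _).const_mul _).aemeasurable
  · rw [integral_finsetSum _ fun p _ => ((hL p).integrable one_le_two).const_mul _]
    refine Finset.sum_eq_zero fun p _ => ?_
    rw [integral_const_mul, h.mean_zero, mul_zero]

end IsSubGaussianEnsemble

/-- The rows of the matrix `B` are unit vectors with disjoint supports. -/
structure IsBlockFrame {l m : ℕ} (B : Matrix (Fin l) (Fin m) ℝ) : Prop where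
  disjoint : ∀ i j t, B i t ≠ 0 → B j t ≠ 0 → i = j
  unit : ∀ i, ∑ t, B i t ^ 2 = 1

variable {l : ℕ} {B : Matrix (Fin l) (Fin m) ℝ}

/-- At each coordinate at most one row is nonzero, so there are no cross terms. Summed over `t`,
this says that the transpose of `B` is an isometry. -/
theorem IsBlockFrame.sq_sum (hB : IsBlockFrame B) (v : Fin l → ℝ) (t : Fin m) :
    (∑ i, v i * B i t) ^ 2 = ∑ i, v i ^ 2 * B i t ^ 2 := by
  by_cases h : ∃ j, B j t ≠ 0
  · obtain ⟨j, hj⟩ := h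
    have h0 : ∀ i, i ≠ j → B i t = 0 := fun i hij => by
      by_contra hne
      exact hij (hB.disjoint i j t hne hj)
    rw [Finset.sum_eq_single j (fun i _ hij => by rw [h0 i hij, mul_zero]) (by simp),
      Finset.sum_eq_single j (fun i _ hij => by rw [h0 i hij]; ring) (by simp)]
    ring
  · push Not at h
    simp [h]

theorem mulVec_measurement_apply (B : Matrix (Fin l) (Fin m) ℝ)
    (A : Fin m → Matrix (Fin n₁) (Fin n₂) ℝ) (Z : Matrix (Fin n₁) (Fin n₂) ℝ) (i : Fin l) :
    B.mulVec (measurement A Z) i =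
      ∑ p : Fin m × Fin n₁ × Fin n₂, (B i p.1 * Z p.2.1 p.2.2) * A p.1 p.2.1 p.2.2 := by
  simp only [Matrix.mulVec, dotProduct, measurement, LinearMap.coe_mk, AddHom.coe_mk,
    Fintype.sum_prod_type, Finset.mul_sum]
  refine Finset.sum_congr rfl fun t _ => Finset.sum_congr rfl fun a _ =>
    Finset.sum_congr rfl fun b _ => by ring

theorem sum_coef_sq (w : Fin m → ℝ) (Z : Matrix (Fin n₁) (Fin n₂) ℝ) :
    ∑ p : Fin m × Fin n₁ × Fin n₂, (w p.1 * Z p.2.1 p.2.2) ^ 2 =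
      (∑ t, w t ^ 2) * frobNorm Z ^ 2 := by
  rw [frobNorm_sq, Finset.sum_mul]
  simp only [Fintype.sum_prod_type, Finset.mul_sum, mul_pow]

/-- The upper tail of a linear functional of the compressed measurements of a fixed matrix. -/
theorem measure_inner_ge_le [IsProbabilityMeasure P] (hK : 0 < K)
    (h : IsSubGaussianEnsemble P K A) (hB : IsBlockFrame B) {Z : Matrix (Fin n₁) (Fin n₂) ℝ}
    (hZ : frobNorm Z ≤ 1) {v : Fin l → ℝ} (hv : ∑ i, v i ^ 2 ≤ 1) {t : ℝ} (ht : 0 ≤ t) :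
    P.real {ω | t ≤ ∑ i, v i * B.mulVec (measurement (A ω) Z) i} ≤
      Real.exp (-t ^ 2 / (68 * K)) := by
  have e : ∀ ω, ∑ i, v i * B.mulVec (measurement (A ω) Z) i =
      ∑ p : Fin m × Fin n₁ × Fin n₂,
        ((∑ i, v i * B i p.1) * Z p.2.1 p.2.2) * A ω p.1 p.2.1 p.2.2 := by
    intro ω
    simp only [mulVec_measurement_apply, Finset.mul_sum, Finset.sum_mul]
    rw [Finset.sum_comm]
    refine Finset.sum_congr rfl fun p _ => Finset.sum_congr rfl fun i _ => by ring
  have hcoef : ∑ p : Fin m × Fin n₁ × Fin n₂, ((∑ i, v i * B i p.1) * Z p.2.1 p.2.2) ^ 2 ≤ 1 := by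
    rw [sum_coef_sq (fun t => ∑ i, v i * B i t) Z]
    have h1 : ∑ t, (∑ i, v i * B i t) ^ 2 = ∑ i, v i ^ 2 := by
      simp only [hB.sq_sum v]
      rw [Finset.sum_comm]
      simp only [← Finset.mul_sum, hB.unit, mul_one]
    rw [h1]
    have := frobNorm_nonneg Z
    exact mul_le_one₀ hv (sq_nonneg _) (pow_le_one₀ this hZ)
  have := (h.hasSubgaussianMGF_linComb hK _ hcoef).measure_ge_le ht
  simp only [e]
  refine this.trans (le_of_eq ?_)
  rw [Real.coe_toNNReal _ (by positivity)]
  ring_nf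

/-- The lower tail of the compressed measurements of a fixed matrix. -/
theorem measure_l2Norm_lt_le [IsProbabilityMeasure P] (hK : 0 < K)
    (h : IsSubGaussianEnsemble P K A) (hB : IsBlockFrame B) (Z : Matrix (Fin n₁) (Fin n₂) ℝ) :
    P.real {ω | l2Norm (B.mulVec (measurement (A ω) Z)) < 1 / 2 * √l * frobNorm Z} ≤
      Real.exp (-(l / (768 * Real.exp (17 * K)))) := by
  by_cases hZ0 : frobNorm Z = 0
  · have : {ω | l2Norm (B.mulVec (measurement (A ω) Z)) < 1 / 2 * √l * frobNorm Z} = ∅ := by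
      ext ω
      simp [hZ0, l2Norm_nonneg]
    rw [this]
    simp [Real.exp_nonneg]
  have hZpos : 0 < frobNorm Z := lt_of_le_of_ne (frobNorm_nonneg Z) (Ne.symm hZ0)
  set W := (frobNorm Z)⁻¹ • Z with hW
  have hW1 : frobNorm W = 1 := by
    rw [hW, frobNorm_smul, abs_of_pos (inv_pos.2 hZpos), inv_mul_cancel₀ hZ0]
  have hZW : Z = frobNorm Z • W := by rw [hW, smul_smul, mul_inv_cancel₀ hZ0, one_smul]
  let Y : Fin l → Ω → ℝ := fun i ω => B.mulVec (measurement (A ω) W) i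
  have hYe : ∀ i ω, Y i ω = ∑ p : Fin m × Fin n₁ × Fin n₂,
      (B i p.1 * W p.2.1 p.2.2) * A ω p.1 p.2.1 p.2.2 :=
    fun i ω => mulVec_measurement_apply _ _ _ _
  have hcoef : ∀ i, ∑ p : Fin m × Fin n₁ × Fin n₂, (B i p.1 * W p.2.1 p.2.2) ^ 2 = 1 := fun i => by
    rw [sum_coef_sq (B i), hB.unit, hW1]; norm_num
  have hmeas : ∀ i, Measurable (Y i) := fun i => by
    rw [funext (hYe i)]
    have := h.measurable
    exact Finset.measurable_sum _ fun p _ => (this _ _ _).const_mul _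
  have hsub : ∀ i, HasSubgaussianMGF (Y i) (34 * K).toNNReal P := fun i => by
    rw [funext (hYe i)]
    exact h.hasSubgaussianMGF_linComb hK _ (hcoef i).le
  have hsq : ∀ i, ∫ ω, Y i ω ^ 2 ∂P = 1 := fun i => by
    simp only [hYe]
    rw [h.integral_linComb_sq hK, hcoef]
  have hind : iIndepFun Y P := by
    classical
    -- Each random entry is labelled by the only row of `B` that sees its measurement, with `none`
    -- for measurements seen by no row. The compressed entries are then sums over distinct labels,
    -- hence independent.
    let b : Fin m × Fin n₁ × Fin n₂ → Option (Fin l) := fun p =>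
      if hp : ∃ i, B i p.1 ≠ 0 then some hp.choose else none
    have hb : ∀ i p, B i p.1 ≠ 0 → b p = some i := by
      intro i p hip
      have hp : ∃ i, B i p.1 ≠ 0 := ⟨i, hip⟩
      simp only [b, dif_pos hp, Option.some.injEq]
      exact hB.disjoint _ _ p.1 hp.choose_spec hip
    let a : Fin m × Fin n₁ × Fin n₂ → ℝ := fun p => (∑ i, B i p.1) * W p.2.1 p.2.2
    have hbs := iIndepFun_blockSum h.indep (fun p => h.measurable _ _ _) b a
    convert hbs.precomp (Option.some_injective (Fin l)) using 1
    ext i ω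
    rw [hYe]
    rw [Finset.sum_filter]
    refine Finset.sum_congr rfl fun p _ => ?_
    by_cases hp : B i p.1 = 0
    · rw [hp]
      split_ifs with hbp
      · have hs : ∑ j, B j p.1 = 0 := by
          refine Finset.sum_eq_zero fun j _ => ?_
          by_contra hj
          have := hb j p hj
          rw [hbp, Option.some.injEq] at this
          exact hj (this ▸ hp)
        simp [a, hs]
      · simp
    · rw [if_pos (hb i p hp)]
      have hs : ∑ j, B j p.1 = B i p.1 :=
        Finset.sum_eq_single i (fun j _ hj => by
          by_contra hne
          exact hj (hB.disjoint _ _ _ hne hp)) (by simp)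
      simp only [a, hs]
  have key := measure_sum_sq_le hind hmeas hsub hsq
  rw [Real.coe_toNNReal _ (by positivity), Fintype.card_fin] at key
  have e17 : 34 * K / 2 = 17 * K := by ring
  rw [e17] at key
  refine (measureReal_mono ?_).trans key
  intro ω hω
  simp only [Set.mem_ofPred_eq] at hω ⊢
  have hl : l2Norm (B.mulVec (measurement (A ω) Z)) =
      frobNorm Z * l2Norm (B.mulVec (measurement (A ω) W)) := by
    conv_lhs => rw [hZW]
    rw [map_smul, Matrix.mulVec_smul, l2Norm_eq_norm, WithLp.toLp_smul, norm_smul,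
      Real.norm_eq_abs, abs_of_pos hZpos, l2Norm_eq_norm]
  rw [hl] at hω
  have h1 : l2Norm (B.mulVec (measurement (A ω) W)) < 1 / 2 * √l := by
    by_contra! hcon
    nlinarith
  have h2 := l2Norm_sq (B.mulVec (measurement (A ω) W))
  have h3 : l2Norm (B.mulVec (measurement (A ω) W)) ^ 2 ≤ (1 / 2 * √l) ^ 2 :=
    pow_le_pow_left₀ (l2Norm_nonneg _) h1.le 2
  rw [mul_pow, Real.sq_sqrt (Nat.cast_nonneg l)] at h3
  change ∑ i, B.mulVec (measurement (A ω) W) i ^ 2 ≤ _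
  have : (0 : ℝ) ≤ l := Nat.cast_nonneg l
  linarith

end Ensemble

/-! ### Uniform bounds over low-rank matrices -/

section LowRank

variable {m n₁ n₂ l R : ℕ}

/-- The left factors of matrices of rank at most `R`, with the operator norm. -/
abbrev LeftFactor (R n₁ : ℕ) := EuclideanSpace ℝ (Fin R) →L[ℝ] EuclideanSpace ℝ (Fin n₁)

/-- The right factors of matrices of rank at most `R`, by columns, with the Frobenius norm. -/
abbrev RightFactor (R n₂ : ℕ) := PiLp 2 fun _ : Fin n₂ => EuclideanSpace ℝ (Fin R)

/-- The product of two factors. -/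
def lowRank (R n₁ n₂ : ℕ) :
    LeftFactor R n₁ →ₗ[ℝ] RightFactor R n₂ →ₗ[ℝ] Matrix (Fin n₁) (Fin n₂) ℝ :=
  LinearMap.mk₂ ℝ (fun x y => Matrix.of fun a j => x (y j) a)
    (fun x x' y => by ext a j; simp) (fun s x y => by ext a j; simp)
    (fun x y y' => by ext a j; simp) (fun s x y => by ext a j; simp)

theorem lowRank_apply (x : LeftFactor R n₁) (y : RightFactor R n₂) (a : Fin n₁) (j : Fin n₂) :
    lowRank R n₁ n₂ x y a j = x (y j) a := rfl

theorem frobNorm_lowRank_le (x : LeftFactor R n₁) (y : RightFactor R n₂) :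
    frobNorm (lowRank R n₁ n₂ x y) ≤ ‖x‖ * ‖y‖ := by
  refine Real.sqrt_le_iff.2 ⟨by positivity, ?_⟩
  rw [mul_pow, PiLp.norm_sq_eq_of_L2, Finset.mul_sum, Finset.sum_comm]
  refine Finset.sum_le_sum fun j _ => ?_
  simp only [lowRank_apply]
  have : ∑ a, (x (y j)) a ^ 2 = ‖x (y j)‖ ^ 2 := by
    rw [EuclideanSpace.real_norm_sq_eq]
  rw [this, ← mul_pow]
  exact pow_le_pow_left₀ (norm_nonneg _) (x.le_opNorm _) 2

theorem finrank_leftFactor : Module.finrank ℝ (LeftFactor R n₁) = R * n₁ := by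
  rw [← (LinearMap.toContinuousLinearMap (𝕜 := ℝ) (E := EuclideanSpace ℝ (Fin R))
    (F' := EuclideanSpace ℝ (Fin n₁))).finrank_eq, Module.finrank_linearMap]
  simp

theorem finrank_rightFactor : Module.finrank ℝ (RightFactor R n₂) = R * n₂ := by
  rw [(WithLp.linearEquiv 2 ℝ (Fin n₂ → EuclideanSpace ℝ (Fin R))).finrank_eq,
    Module.finrank_pi_fintype]
  simp [mul_comm]

/-- The compressed measurements of a product, as a bilinear map of the factors. -/
def compressed (B : Matrix (Fin l) (Fin m) ℝ) (A : Fin m → Matrix (Fin n₁) (Fin n₂) ℝ) (R : ℕ) :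
    LeftFactor R n₁ →ₗ[ℝ] RightFactor R n₂ →ₗ[ℝ] EuclideanSpace ℝ (Fin l) :=
  (lowRank R n₁ n₂).compr₂ ((WithLp.linearEquiv 2 ℝ (Fin l → ℝ)).symm.toLinearMap ∘ₗ
    B.mulVecLin ∘ₗ measurement A)

theorem norm_compressed (B : Matrix (Fin l) (Fin m) ℝ) (A : Fin m → Matrix (Fin n₁) (Fin n₂) ℝ)
    (x : LeftFactor R n₁) (y : RightFactor R n₂) :
    ‖compressed B A R x y‖ = l2Norm (B.mulVec (measurement A (lowRank R n₁ n₂ x y))) := by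
  rw [l2Norm_eq_norm]; rfl

/-- The uniform bounds for the compressed measurements of matrices of rank at most `R`. -/
def HasLowRankBounds (B : Matrix (Fin l) (Fin m) ℝ) (A : Fin m → Matrix (Fin n₁) (Fin n₂) ℝ)
    (R : ℕ) (U : ℝ) : Prop :=
  ∀ (x : LeftFactor R n₁) (y : RightFactor R n₂),
    l2Norm (B.mulVec (measurement A (lowRank R n₁ n₂ x y))) ≤ U * √l * ‖x‖ * ‖y‖ ∧
    (‖x‖ ≤ 1 → frobNorm (lowRank R n₁ n₂ x y) = ‖y‖ →
      1 / 4 * √l * ‖y‖ ≤ l2Norm (B.mulVec (measurement A (lowRank R n₁ n₂ x y))))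

/-- Bounds on nets imply uniform bounds. -/
theorem hasLowRankBounds_of_net {B : Matrix (Fin l) (Fin m) ℝ}
    {A : Fin m → Matrix (Fin n₁) (Fin n₂) ℝ} {T ε : ℝ} (hT : 0 < T) (hε0 : 0 < ε)
    (hε : ε * (8 * (4 * T) + 8) ≤ 1)
    {s : Set (LeftFactor R n₁)} {t : Set (RightFactor R n₂)} {N : Set (EuclideanSpace ℝ (Fin l))}
    (hs1 : ∀ x ∈ s, ‖x‖ ≤ 1) (hs : ∀ x : LeftFactor R n₁, ‖x‖ ≤ 1 → ∃ c ∈ s, ‖x - c‖ ≤ ε)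
    (ht : ∀ y : RightFactor R n₂, ‖y‖ ≤ 1 → ∃ c ∈ t, ‖y - c‖ ≤ ε)
    (hN : ∀ v : EuclideanSpace ℝ (Fin l), ‖v‖ ≤ 1 → ∃ c ∈ N, ‖v - c‖ ≤ 1 / 2)
    (hup : ∀ x ∈ s, ∀ y ∈ t, ∀ v ∈ N,
      ∑ i, v i * B.mulVec (measurement A (lowRank R n₁ n₂ x y)) i ≤ T * √l)
    (hlow : ∀ x ∈ s, ∀ y ∈ t, 1 / 2 * √l * frobNorm (lowRank R n₁ n₂ x y) ≤
      l2Norm (B.mulVec (measurement A (lowRank R n₁ n₂ x y)))) :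
    HasLowRankBounds B A R (4 * T) := by
  have hU : ∀ x y, ‖compressed B A R x y‖ ≤ 4 * T * √l * ‖x‖ * ‖y‖ := by
    intro x y
    -- One factor `2` comes from testing against the net `N`, the other from the nets of the two
    -- factors; hence `4 T`.
    have := bilinear_le_of_net (compressed B A R) (ε := ε) (M := 2 * (T * √l))
      (by nlinarith) hs1 hs ht (fun x hx y hy => norm_le_of_net hN fun v hv => ?_) x y
    · linarith
    · refine le_trans (le_of_eq ?_) (hup x hx y hy v hv)
      rw [PiLp.inner_apply]
      refine Finset.sum_congr rfl fun i _ => ?_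
      rw [Real.inner_apply]
      rfl
  have hl : 0 ≤ √(l : ℝ) := Real.sqrt_nonneg _
  -- Passing to net points loses `8 T ε √l` in the compressed norm and `2 ε` in the Frobenius norm.
  -- The condition on `ε` keeps the total loss below `√l / 4`.
  have unit : ∀ x y, ‖x‖ ≤ 1 → ‖y‖ ≤ 1 →
      √l * (1 / 2 * frobNorm (lowRank R n₁ n₂ x y) - 1 / 4) ≤ ‖compressed B A R x y‖ := by
    intro x y hx hy
    obtain ⟨x', hx', hxx⟩ := hs x hx
    obtain ⟨y', hy', hyy⟩ := ht y hy
    have e : compressed B A R x' y' =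
        compressed B A R x y + compressed B A R (x' - x) y + compressed B A R x' (y' - y) := by
      simp only [map_sub, LinearMap.sub_apply]; abel
    have e2 : lowRank R n₁ n₂ x y =
        lowRank R n₁ n₂ x' y' + (lowRank R n₁ n₂ (x - x') y + lowRank R n₁ n₂ x' (y - y')) := by
      simp only [map_sub, LinearMap.sub_apply]; abel
    have hxx' : ‖x' - x‖ ≤ ε := by rwa [norm_sub_rev]
    have hyy' : ‖y' - y‖ ≤ ε := by rwa [norm_sub_rev]
    have b1 : ‖compressed B A R (x' - x) y‖ ≤ 4 * T * √l * ε * 1 :=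
      (hU _ _).trans (by gcongr)
    have b2 : ‖compressed B A R x' (y' - y)‖ ≤ 4 * T * √l * 1 * ε :=
      (hU _ _).trans (by gcongr; exact hs1 x' hx')
    have f1 : frobNorm (lowRank R n₁ n₂ (x - x') y) ≤ ε * 1 :=
      (frobNorm_lowRank_le _ _).trans (by gcongr)
    have f2 : frobNorm (lowRank R n₁ n₂ x' (y - y')) ≤ 1 * ε :=
      (frobNorm_lowRank_le _ _).trans (by gcongr; exact hs1 x' hx')
    have g1 : ‖compressed B A R x' y'‖ ≤ ‖compressed B A R x y‖ + 4 * T * √l * ε * 1 +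
        4 * T * √l * 1 * ε := by
      rw [e]
      exact norm_add₃_le.trans (by gcongr)
    have g2 : frobNorm (lowRank R n₁ n₂ x y) ≤ frobNorm (lowRank R n₁ n₂ x' y') + 2 * ε := by
      rw [e2]
      refine (frobNorm_add_le _ _).trans ?_
      linarith [frobNorm_add_le (lowRank R n₁ n₂ (x - x') y) (lowRank R n₁ n₂ x' (y - y'))]
    have g3 := hlow x' hx' y' hy'
    rw [← norm_compressed] at g3
    have g4 : √l * (1 / 2 * frobNorm (lowRank R n₁ n₂ x y)) ≤
        √l * (1 / 2 * (frobNorm (lowRank R n₁ n₂ x' y') + 2 * ε)) := by gcongr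
    have g5 : √l * (ε * (8 * (4 * T) + 8)) ≤ √l * 1 := by gcongr
    have g6 : 0 ≤ √l * ε := by positivity
    linarith
  intro x y
  rw [← norm_compressed]
  refine ⟨hU x y, fun hx hxy => ?_⟩
  by_cases hy : y = 0
  · simp [hy]
  have hy0 : 0 < ‖y‖ := norm_pos_iff.2 hy
  have h1 := unit x (‖y‖⁻¹ • y) hx (by rw [norm_smul, norm_inv, norm_norm]; field_simp; simp)
  rw [map_smul, map_smul, frobNorm_smul, hxy, abs_of_pos (inv_pos.2 hy0), inv_mul_cancel₀ hy0.ne',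
    norm_smul, norm_inv, norm_norm] at h1
  have h2 := mul_le_mul_of_nonneg_right h1 hy0.le
  have e : ‖y‖⁻¹ * ‖compressed B A R x y‖ * ‖y‖ = ‖compressed B A R x y‖ := by field_simp
  rw [e] at h2
  linarith

/-- With high probability the uniform bounds hold. -/
theorem exists_lowRank_constants {K : ℝ} (hK : 0 < K) :
    ∃ U c₀ Θ : ℝ, 0 < U ∧ 0 < c₀ ∧ 0 < Θ ∧
      ∀ {n₁ n₂ m l : ℕ} (R : ℕ) {Ω : Type*} [MeasurableSpace Ω] {P : Measure Ω}
        [IsProbabilityMeasure P] {A : Ω → Fin m → Matrix (Fin n₁) (Fin n₂) ℝ}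
        {B : Matrix (Fin l) (Fin m) ℝ}, IsSubGaussianEnsemble P K A → IsBlockFrame B →
        R * (n₁ + n₂) * Θ ≤ l →
        P.real {ω | ¬ HasLowRankBounds B (A ω) R U} ≤ 2 * Real.exp (-c₀ * l) := by
  set q : ℝ := 1 / (768 * Real.exp (17 * K)) with hq
  have hq0 : 0 < q := by positivity
  -- With this `T` one upper-tail event has probability at most `e^{-(2 + q) l}`. The net `N` has at
  -- most `5^l ≤ e^{2 l}` points, so the union over `N` costs `e^{-q l}`, the same as the lower
  -- tail.
  set T : ℝ := √(68 * K * (2 + q)) with hT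
  have hT0 : 0 < T := by positivity
  set ε : ℝ := 1 / (8 * (4 * T) + 8) with hε
  have hε0 : 0 < ε := by positivity
  have hlog : 0 < Real.log (1 + 2 / ε) := Real.log_pos (by
    have : 0 < 2 / ε := by positivity
    linarith)
  -- The value of `Θ` makes the number of pairs of net points at most `e^{q l / 2}`, half of the
  -- available exponent.
  refine ⟨4 * T, q / 2, 2 * Real.log (1 + 2 / ε) / q, by positivity, by positivity, by positivity,
    ?_⟩
  intro n₁ n₂ m l R Ω _ P _ A B hA hB hR
  obtain ⟨s, hscard, hs1, hs⟩ := exists_unitBall_net (LeftFactor R n₁) hε0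
  obtain ⟨t, htcard, ht1, ht⟩ := exists_unitBall_net (RightFactor R n₂) hε0
  obtain ⟨N, hNcard, hN1, hN⟩ := exists_unitBall_net (EuclideanSpace ℝ (Fin l))
    (one_half_pos (α := ℝ))
  rw [finrank_leftFactor] at hscard
  rw [finrank_rightFactor] at htcard
  rw [finrank_euclideanSpace_fin] at hNcard
  let bad : LeftFactor R n₁ × RightFactor R n₂ → Set Ω := fun p =>
    (⋃ v ∈ N, {ω | T * √l ≤ ∑ i, v i *
      B.mulVec (measurement (A ω) (lowRank R n₁ n₂ p.1 p.2)) i}) ∪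
    {ω | l2Norm (B.mulVec (measurement (A ω) (lowRank R n₁ n₂ p.1 p.2))) <
      1 / 2 * √l * frobNorm (lowRank R n₁ n₂ p.1 p.2)}
  have hsub : {ω | ¬ HasLowRankBounds B (A ω) R (4 * T)} ⊆ ⋃ p ∈ s ×ˢ t, bad p := by
    intro ω hω
    by_contra hcon
    simp only [Set.mem_iUnion, not_exists, bad, Set.mem_union, Set.mem_ofPred_eq, not_or,
      not_le, not_lt, Finset.mem_product, and_imp, Prod.forall] at hcon
    refine hω (hasLowRankBounds_of_net hT0 hε0 (by rw [hε]; field_simp; simp) (s := (s : Set _))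
      (t := (t : Set _)) (N := (N : Set _)) hs1 hs ht hN ?_ ?_)
    · intro x hx y hy v hv
      exact ((hcon x y hx hy).1 v hv).le
    · intro x hx y hy
      exact (hcon x y hx hy).2
  have hbad : ∀ p ∈ s ×ˢ t, P.real (bad p) ≤ 2 * Real.exp (-(q * l)) := by
    intro p hp
    rw [Finset.mem_product] at hp
    have hZ : frobNorm (lowRank R n₁ n₂ p.1 p.2) ≤ 1 :=
      (frobNorm_lowRank_le _ _).trans (mul_le_one₀ (hs1 _ hp.1) (norm_nonneg _) (ht1 _ hp.2))
    have h1 : P.real (⋃ v ∈ N, {ω | T * √l ≤ ∑ i, v i *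
        B.mulVec (measurement (A ω) (lowRank R n₁ n₂ p.1 p.2)) i}) ≤ Real.exp (-(q * l)) := by
      refine (measureReal_biUnion_finset_le _ _).trans ?_
      calc _ ≤ ∑ v ∈ N, Real.exp (-((2 + q) * l)) := by
            refine Finset.sum_le_sum fun v hv => ?_
            have hv1 : ∑ i, v i ^ 2 ≤ 1 := by
              rw [← EuclideanSpace.real_norm_sq_eq]
              exact pow_le_one₀ (norm_nonneg _) (hN1 v hv)
            refine (measure_inner_ge_le hK hA hB hZ hv1 (by positivity)).trans (le_of_eq ?_)
            congr 1
            rw [mul_pow, Real.sq_sqrt (Nat.cast_nonneg l), hT, Real.sq_sqrt (by positivity)]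
            field_simp
        _ = N.card * Real.exp (-((2 + q) * l)) := by simp
        _ ≤ Real.exp (2 * l) * Real.exp (-((2 + q) * l)) := by
            gcongr
            refine hNcard.trans ?_
            have : (1 + 2 / (1 / 2) : ℝ) ≤ Real.exp 2 := by
              have h := Real.exp_one_gt_d9
              have : Real.exp 2 = Real.exp 1 * Real.exp 1 := by rw [← Real.exp_add]; norm_num
              rw [this]
              nlinarith
            rw [mul_comm, Real.exp_nat_mul]
            exact pow_le_pow_left₀ (by norm_num) this l
        _ = _ := by rw [← Real.exp_add]; congr 1; ring
    have h2 := measure_l2Norm_lt_le hK hA hB (lowRank R n₁ n₂ p.1 p.2)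
    have h3 : -((l : ℝ) / (768 * Real.exp (17 * K))) = -(q * l) := by rw [hq]; ring
    rw [h3] at h2
    refine (measureReal_union_le _ _).trans ?_
    linarith
  have hcard : ((s ×ˢ t).card : ℝ) ≤ Real.exp (q / 2 * l) := by
    rw [Finset.card_product]
    push_cast
    calc (s.card : ℝ) * t.card ≤ (1 + 2 / ε) ^ (R * n₁) * (1 + 2 / ε) ^ (R * n₂) := by gcongr
      _ = Real.exp (Real.log (1 + 2 / ε)) ^ (R * (n₁ + n₂)) := by
          rw [Real.exp_log (by positivity), ← pow_add, mul_add]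
      _ = Real.exp ((R * (n₁ + n₂) : ℕ) * Real.log (1 + 2 / ε)) := by rw [Real.exp_nat_mul]
      _ ≤ _ := by
          refine Real.exp_le_exp.2 ?_
          have : (R * (n₁ + n₂) : ℝ) * (2 * Real.log (1 + 2 / ε) / q) * (q / 2) ≤ l * (q / 2) := by
            gcongr
          have e : (R * (n₁ + n₂) : ℝ) * (2 * Real.log (1 + 2 / ε) / q) * (q / 2) =
            (R * (n₁ + n₂) : ℝ) * Real.log (1 + 2 / ε) := by field_simp
          push_cast
          linarith
  calc P.real {ω | ¬ HasLowRankBounds B (A ω) R (4 * T)}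
      ≤ P.real (⋃ p ∈ s ×ˢ t, bad p) := measureReal_mono hsub (measure_ne_top _ _)
    _ ≤ ∑ p ∈ s ×ˢ t, P.real (bad p) := measureReal_biUnion_finset_le _ _
    _ ≤ ∑ p ∈ s ×ˢ t, 2 * Real.exp (-(q * l)) := Finset.sum_le_sum hbad
    _ = (s ×ˢ t).card * (2 * Real.exp (-(q * l))) := by simp
    _ ≤ Real.exp (q / 2 * l) * (2 * Real.exp (-(q * l))) := by gcongr
    _ = 2 * (Real.exp (q / 2 * l) * Real.exp (-(q * l))) := by ring
    _ = _ := by rw [← Real.exp_add]; congr 2; ring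

end LowRank

/-! ### A block frame adapted to the difference matrix -/

section BlockFrame

open Polynomial

/-- The coefficients of a polynomial in decreasing order, the constant one at position `o`. -/
def coeffRow (m o : ℕ) (p : ℝ[X]) : Fin m → ℝ := fun t => if (t : ℕ) ≤ o then p.coeff (o - t) else 0

/-- With coefficients stored in decreasing order, entry `s` of `v D` is `v s - v (s + 1)`, which is
the coefficient rule for multiplication by `1 - X`. Thus difference operators become polynomial
algebra. -/
theorem coeffRow_vecMul_diffMatrix {m o : ℕ} (ho : o < m) (p : ℝ[X]) :
    Matrix.vecMul (coeffRow m o p) (diffMatrix m) = coeffRow m o ((1 - X) * p) := by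
  ext s
  have h : ∀ t : Fin m, coeffRow m o p t * diffMatrix m t s =
      (if t = s then coeffRow m o p s else 0) -
        (if (t : ℕ) = s + 1 then coeffRow m o p t else 0) := by
    intro t
    by_cases h1 : t = s
    · subst h1
      simp [diffMatrix]
    · by_cases h2 : (t : ℕ) = s + 1 <;> simp [diffMatrix, h1, h2]
  simp only [Matrix.vecMul, dotProduct]
  rw [Finset.sum_congr rfl fun t _ => h t, Finset.sum_sub_distrib]
  rw [Finset.sum_ite_eq' Finset.univ s, if_pos (Finset.mem_univ s)]
  have h3 : ∑ t : Fin m, (if (t : ℕ) = s + 1 then coeffRow m o p t else 0) =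
      if (s : ℕ) + 1 ≤ o then p.coeff (o - (s + 1)) else 0 := by
    split_ifs with hs
    · rw [Finset.sum_eq_single ⟨s + 1, by omega⟩]
      · simp [coeffRow, hs]
      · intro t _ ht
        have : (t : ℕ) ≠ s + 1 := fun h => ht (Fin.ext h)
        simp [this]
      · simp
    · refine Finset.sum_eq_zero fun t _ => ?_
      split_ifs with ht
      · simp [coeffRow, ht, hs]
      · rfl
  rw [h3]
  simp only [coeffRow, sub_mul, one_mul, coeff_sub]
  by_cases h4 : (s : ℕ) + 1 ≤ o
  · obtain ⟨d, hd⟩ : ∃ d, o = s + 1 + d := ⟨o - (s + 1), by omega⟩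
    have e1 : o - s = d + 1 := by omega
    have e2 : o - (s + 1) = d := by omega
    rw [if_pos (by omega), if_pos h4, if_pos (by omega), e1, e2, coeff_X_mul]
  · rw [if_neg h4]
    split_ifs with h5
    · have : o - s = 0 := by omega
      simp [this]
    · simp

theorem coeffRow_vecMul_diffMatrix_pow {m o : ℕ} (ho : o < m) (p : ℝ[X]) (r : ℕ) :
    Matrix.vecMul (coeffRow m o p) (diffMatrix m ^ r) = coeffRow m o ((1 - X) ^ r * p) := by
  induction r with
  | zero => simp
  | succ r ih =>
    rw [pow_succ, ← Matrix.vecMul_vecMul, ih, coeffRow_vecMul_diffMatrix ho]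
    congr 1
    ring

theorem sum_coeffRow_sq {m o N : ℕ} (ho : o < m) (hN : N ≤ o + 1) {p : ℝ[X]}
    (hp : ∀ i, N ≤ i → p.coeff i = 0) :
    ∑ t, coeffRow m o p t ^ 2 = ∑ i ∈ Finset.range N, p.coeff i ^ 2 := by
  have h1 : ∑ t, coeffRow m o p t ^ 2 =
      ∑ t ∈ Finset.range m, (if t ≤ o then p.coeff (o - t) else 0) ^ 2 :=
    Fin.sum_univ_eq_sum_range (fun t => (if t ≤ o then p.coeff (o - t) else 0) ^ 2) m
  rw [h1]
  have h2 : ∑ t ∈ Finset.range (o + 1), (if t ≤ o then p.coeff (o - t) else 0) ^ 2 =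
      ∑ t ∈ Finset.range m, (if t ≤ o then p.coeff (o - t) else 0) ^ 2 := by
    refine Finset.sum_subset (Finset.range_subset_range.2 ho) fun t _ ht => ?_
    rw [Finset.mem_range, not_lt] at ht
    rw [if_neg (by omega)]
    simp
  have h3 : ∑ t ∈ Finset.range (o + 1), (if t ≤ o then p.coeff (o - t) else 0) ^ 2 =
      ∑ t ∈ Finset.range (o + 1), p.coeff (o + 1 - 1 - t) ^ 2 := by
    refine Finset.sum_congr rfl fun t ht => ?_
    rw [Finset.mem_range] at ht
    rw [if_pos (by omega), Nat.add_sub_cancel]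
  rw [← h2, h3, Finset.sum_range_reflect (fun i => p.coeff i ^ 2)]
  symm
  refine Finset.sum_subset (Finset.range_subset_range.2 hN) fun t _ ht => ?_
  rw [Finset.mem_range, not_lt] at ht
  rw [hp t ht]
  simp

/-- A polynomial with at most `N` coefficients placed at offset `i N + (N - 1)` occupies exactly the
`i`-th window of length `N`; this yields disjoint supports. -/
theorem coeffRow_ne_zero {m i N : ℕ} {p : ℝ[X]} (hN : 1 ≤ N) (hp : ∀ j, N ≤ j → p.coeff j = 0)
    {t : Fin m} (h : coeffRow m (i * N + (N - 1)) p t ≠ 0) : (t : ℕ) / N = i := by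
  unfold coeffRow at h
  split_ifs at h with h1
  · have h2 : i * N + (N - 1) - t < N := by
      by_contra hcon
      exact h (hp _ (not_lt.1 hcon))
    rw [Nat.div_eq_iff (by omega)]
    omega
  · exact absurd rfl h

/-- The generating polynomial of the discrete B-spline of order `r + 1` and width `w`. -/
def spline (r w : ℕ) : ℝ[X] := (∑ j ∈ Finset.range w, X ^ j) ^ (r + 1)

/-- Differencing a spline `r` times telescopes `r` of its `r + 1` box factors. This is the source of
the damping: what remains has coefficients bounded independently of `w`. -/
theorem one_sub_X_pow_mul_spline (r w : ℕ) :
    (1 - X) ^ r * spline r w = (1 - X ^ w) ^ r * ∑ j ∈ Finset.range w, (X : ℝ[X]) ^ j := by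
  rw [spline, pow_succ, ← mul_assoc, ← mul_pow, mul_neg_geom_sum]

/-- The geometric sum has coefficients `0` and `1`, and each factor `1 - X ^ w` at most doubles the
largest coefficient. -/
theorem abs_coeff_le (r w i : ℕ) :
    |((1 - X ^ w) ^ r * ∑ j ∈ Finset.range w, (X : ℝ[X]) ^ j).coeff i| ≤ 2 ^ r := by
  induction r generalizing i with
  | zero =>
    simp only [pow_zero, one_mul, finsetSum_coeff, coeff_X_pow]
    rw [Finset.sum_ite_eq]
    split_ifs <;> simp
  | succ r ih =>
    rw [pow_succ', mul_assoc, sub_mul, one_mul, coeff_sub, coeff_X_pow_mul']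
    have h1 := ih i
    split_ifs
    · have h2 := ih (i - w)
      rw [pow_succ]
      exact (abs_sub _ _).trans (by linarith)
    · rw [sub_zero, pow_succ]
      linarith [abs_nonneg (((1 - X ^ w) ^ r * ∑ j ∈ Finset.range w, (X : ℝ[X]) ^ j).coeff i)]

theorem natDegree_geom_le (w : ℕ) :
    (∑ j ∈ Finset.range w, (X : ℝ[X]) ^ j).natDegree ≤ w - 1 := by
  refine natDegree_sum_le_of_forall_le _ _ fun j hj => ?_
  rw [Finset.mem_range] at hj
  rw [natDegree_X_pow]
  omega

theorem coeff_diff_spline_eq_zero {r s w i : ℕ} (hs : s ≤ r) (hw : 1 ≤ w) (hi : (r + 1) * w ≤ i) :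
    ((1 - X) ^ s * spline r w).coeff i = 0 := by
  have h1 : (1 - X : ℝ[X]).natDegree ≤ 1 := by
    have := natDegree_sub_le (1 : ℝ[X]) X
    simpa using this
  have h2 : ((1 - X : ℝ[X]) ^ s).natDegree ≤ s * 1 := natDegree_pow_le_of_le s h1
  have h3 : (spline r w).natDegree ≤ (r + 1) * (w - 1) :=
    natDegree_pow_le_of_le (r + 1) (natDegree_geom_le w)
  refine coeff_eq_zero_of_natDegree_lt (lt_of_le_of_lt (natDegree_mul_le_of_le h2 h3)
    (lt_of_lt_of_le ?_ hi))
  obtain ⟨v, rfl⟩ : ∃ v, w = v + 1 := ⟨w - 1, by omega⟩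
  simp only [Nat.add_sub_cancel]
  nlinarith

/-- The coefficients sum to the value at `1`, which is `w ^ (r + 1)`; Cauchy–Schwarz over the `(r +
1) w` possible coefficients gives the bound used to normalize the rows. -/
theorem sum_coeff_spline_sq_ge {r w : ℕ} (hw : 1 ≤ w) :
    ((w : ℝ) ^ (r + 1)) ^ 2 ≤
      ((r + 1) * w) * ∑ i ∈ Finset.range ((r + 1) * w), (spline r w).coeff i ^ 2 := by
  have heval : (spline r w).eval 1 = (w : ℝ) ^ (r + 1) := by
    simp [spline, eval_finsetSum]
  have hdeg : (spline r w).natDegree < (r + 1) * w := by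
    refine lt_of_le_of_lt (natDegree_pow_le_of_le (r + 1) (natDegree_geom_le w)) ?_
    gcongr
    omega
  have hsum := eval_eq_sum_range' hdeg (1 : ℝ)
  simp only [one_pow, mul_one] at hsum
  rw [← heval, hsum]
  have := sq_sum_le_card_mul_sum_sq (s := Finset.range ((r + 1) * w))
    (f := fun i => (spline r w).coeff i)
  rw [Finset.card_range] at this
  push_cast at this
  exact this

/-- The operator norm of a matrix with disjointly supported rows. -/
theorem l2Norm_mulVec_le_of_disjoint {l m : ℕ} {H : Matrix (Fin l) (Fin m) ℝ} {ρ : ℝ} (hρ : 0 ≤ ρ)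
    (hd : ∀ i j t, H i t ≠ 0 → H j t ≠ 0 → i = j) (hrow : ∀ i, ∑ t, H i t ^ 2 ≤ ρ ^ 2)
    (u : Fin m → ℝ) : l2Norm (H.mulVec u) ≤ ρ * l2Norm u := by
  classical
  refine Real.sqrt_le_iff.2 ⟨mul_nonneg hρ (l2Norm_nonneg u), ?_⟩
  rw [mul_pow, l2Norm_sq]
  calc ∑ i, (H.mulVec u i) ^ 2
      ≤ ∑ i, ρ ^ 2 * ∑ t, (if H i t ≠ 0 then u t ^ 2 else 0) := by
        refine Finset.sum_le_sum fun i _ => ?_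
        have e : H.mulVec u i = ∑ t, H i t * (if H i t ≠ 0 then u t else 0) := by
          simp only [Matrix.mulVec, dotProduct]
          refine Finset.sum_congr rfl fun t _ => ?_
          split_ifs with h
          · rfl
          · rw [not_not.1 h, zero_mul, zero_mul]
        rw [e]
        refine (Finset.sum_mul_sq_le_sq_mul_sq _ _ _).trans ?_
        have e2 : ∑ t, (if H i t ≠ 0 then u t else 0) ^ 2 =
            ∑ t, (if H i t ≠ 0 then u t ^ 2 else 0) := by
          refine Finset.sum_congr rfl fun t _ => ?_
          split_ifs <;> simp
        rw [e2]
        refine mul_le_mul_of_nonneg_right (hrow i) (Finset.sum_nonneg fun t _ => ?_)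
        split_ifs <;> positivity
    _ = ρ ^ 2 * ∑ t, ∑ i, (if H i t ≠ 0 then u t ^ 2 else 0) := by
        rw [← Finset.mul_sum, Finset.sum_comm]
    _ ≤ ρ ^ 2 * ∑ t, u t ^ 2 := by
        gcongr with t
        by_cases h : ∃ j, H j t ≠ 0
        · obtain ⟨j, hj⟩ := h
          rw [Finset.sum_eq_single j]
          · rw [if_pos hj]
          · intro i _ hij
            rw [if_neg]
            exact fun hi => hij (hd i j t hi hj)
          · simp
        · push Not at h
          simp only [h, ne_eq, not_true_eq_false, if_false, Finset.sum_const_zero]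
          positivity

/-- There is a block frame whose rows are damped by the powers of the difference matrix. -/
theorem exists_isBlockFrame {l m r w : ℕ} (hw : 1 ≤ w) (hm : l * ((r + 1) * w) ≤ m) :
    ∃ B : Matrix (Fin l) (Fin m) ℝ, IsBlockFrame B ∧
      ∀ u, l2Norm ((B * diffMatrix m ^ r).mulVec u) ≤ (r + 1) * (2 / w) ^ r * l2Norm u := by
  set N := (r + 1) * w with hN
  have hN1 : 1 ≤ N := Nat.mul_pos (Nat.succ_pos r) hw
  set S : ℝ := ∑ i ∈ Finset.range N, (spline r w).coeff i ^ 2 with hS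
  have hSge := sum_coeff_spline_sq_ge (r := r) hw
  rw [← hN, ← hS] at hSge
  have hw0 : (0 : ℝ) < w := by exact_mod_cast hw
  have hSpos : 0 < S := by
    by_contra! hcon
    have : 0 < ((w : ℝ) ^ (r + 1)) ^ 2 := by positivity
    have h2 : ((r : ℝ) + 1) * w * S ≤ 0 := mul_nonpos_of_nonneg_of_nonpos (by positivity) hcon
    linarith
  have ho : ∀ i : Fin l, (i : ℕ) * N + (N - 1) < m := by
    intro i
    have h1 : ((i : ℕ) + 1) * N ≤ l * N := Nat.mul_le_mul_right _ i.2
    rw [add_mul, one_mul] at h1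
    omega
  have hp0 : ∀ j, N ≤ j → (spline r w).coeff j = 0 := fun j hj => by
    simpa using coeff_diff_spline_eq_zero (Nat.zero_le r) hw hj
  have hpr : ∀ j, N ≤ j → ((1 - X) ^ r * spline r w).coeff j = 0 := fun j hj =>
    coeff_diff_spline_eq_zero le_rfl hw hj
  let B : Matrix (Fin l) (Fin m) ℝ :=
    Matrix.of fun i => (√S)⁻¹ • coeffRow m (i * N + (N - 1)) (spline r w)
  have hBD : ∀ i, (B * diffMatrix m ^ r) i =
      (√S)⁻¹ • coeffRow m (i * N + (N - 1)) ((1 - X) ^ r * spline r w) := by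
    intro i
    rw [Matrix.mul_apply_eq_vecMul]
    change Matrix.vecMul ((√S)⁻¹ • coeffRow m (i * N + (N - 1)) (spline r w)) _ = _
    rw [Matrix.smul_vecMul, coeffRow_vecMul_diffMatrix_pow (ho i)]
  have hSinv : (√S)⁻¹ ^ 2 = S⁻¹ := by rw [inv_pow, Real.sq_sqrt hSpos.le]
  refine ⟨B, ⟨?_, ?_⟩, l2Norm_mulVec_le_of_disjoint (by positivity) ?_ ?_⟩
  · intro i j t hi hj
    have h1 := coeffRow_ne_zero hN1 hp0 (right_ne_zero_of_mul hi)
    have h2 := coeffRow_ne_zero hN1 hp0 (right_ne_zero_of_mul hj)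
    exact Fin.ext (h1.symm.trans h2)
  · intro i
    have : ∀ t, B i t ^ 2 = S⁻¹ * coeffRow m (i * N + (N - 1)) (spline r w) t ^ 2 := fun t => by
      rw [← hSinv, ← mul_pow]; rfl
    simp only [this]
    rw [← Finset.mul_sum, sum_coeffRow_sq (ho i) (by omega) hp0, ← hS, inv_mul_cancel₀ hSpos.ne']
  · intro i j t hi hj
    rw [hBD] at hi hj
    have h1 := coeffRow_ne_zero hN1 hpr (right_ne_zero_of_mul hi)
    have h2 := coeffRow_ne_zero hN1 hpr (right_ne_zero_of_mul hj)
    exact Fin.ext (h1.symm.trans h2)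
  · intro i
    have : ∀ t, (B * diffMatrix m ^ r) i t ^ 2 =
        S⁻¹ * coeffRow m (i * N + (N - 1)) ((1 - X) ^ r * spline r w) t ^ 2 := fun t => by
      rw [← hSinv, ← mul_pow, hBD]; rfl
    simp only [this]
    rw [← Finset.mul_sum, sum_coeffRow_sq (ho i) (by omega) hpr]
    have hb : ∑ j ∈ Finset.range N, ((1 - X) ^ r * spline r w).coeff j ^ 2 ≤
        (((r : ℝ) + 1) * w) * (2 ^ r) ^ 2 := by
      calc _ ≤ ∑ j ∈ Finset.range N, ((2 : ℝ) ^ r) ^ 2 := by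
            refine Finset.sum_le_sum fun j _ => ?_
            rw [one_sub_X_pow_mul_spline, ← sq_abs]
            exact pow_le_pow_left₀ (abs_nonneg _) (abs_coeff_le r w j) 2
        _ = _ := by simp [hN]
    rw [inv_mul_le_iff₀ hSpos]
    refine hb.trans ?_
    -- This isolates `(r + 1) w S`, so that the Cauchy–Schwarz lower bound for `S` applies directly.
    have e : S * ((r + 1) * (2 / (w : ℝ)) ^ r) ^ 2 =
        ((r + 1) * w * S) * ((r + 1) * (2 ^ r) ^ 2 / (w ^ (2 * r + 1))) := by
      rw [div_pow]
      field_simp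
      ring
    rw [e]
    calc ((r : ℝ) + 1) * w * (2 ^ r) ^ 2
        = ((w : ℝ) ^ (r + 1)) ^ 2 * ((r + 1) * (2 ^ r) ^ 2 / (w ^ (2 * r + 1))) := by
          field_simp
          ring
      _ ≤ _ := by gcongr

theorem det_diffMatrix (m : ℕ) : (diffMatrix m).det = 1 := by
  have h : (diffMatrix m).BlockTriangular OrderDual.toDual := fun i j hij => by
    simpa using diffMatrix_pow_apply_lt 1 (show i < j from hij)
  rw [Matrix.det_of_isLowerTriangular _ h]
  exact Finset.prod_eq_one fun i _ => by simpa using diffMatrix_pow_apply_self 1 i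

theorem diffMatrix_pow_mul_inv_pow (m r : ℕ) : diffMatrix m ^ r * (diffMatrix m)⁻¹ ^ r = 1 := by
  have h : IsUnit (diffMatrix m).det := by rw [det_diffMatrix]; exact isUnit_one
  rw [← Commute.mul_pow, Matrix.mul_nonsing_inv _ h, one_pow]
  rw [Commute, SemiconjBy, Matrix.mul_nonsing_inv _ h, Matrix.nonsing_inv_mul _ h]

end BlockFrame

/-! ### Singular value decomposition and the nuclear norm -/

section Nuclear

open Matrix

variable {n₁ n₂ : ℕ}

/-- The `i`-th singular value of a matrix, starting with `0`. -/
def sv (X : Matrix (Fin n₁) (Fin n₂) ℝ) (i : ℕ) : ℝ := (Matrix.toEuclideanLin X).singularValues i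

theorem sv_nonneg (X : Matrix (Fin n₁) (Fin n₂) ℝ) (i : ℕ) : 0 ≤ sv X i :=
  LinearMap.singularValues_nonneg _ _

theorem sv_antitone (X : Matrix (Fin n₁) (Fin n₂) ℝ) : Antitone (sv X) :=
  LinearMap.singularValues_antitone _

theorem sv_of_le (X : Matrix (Fin n₁) (Fin n₂) ℝ) {i : ℕ} (hi : n₂ ≤ i) : sv X i = 0 :=
  LinearMap.singularValues_of_finrank_le _ (by rwa [finrank_euclideanSpace_fin])

theorem nuclearNorm_eq (X : Matrix (Fin n₁) (Fin n₂) ℝ) :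
    nuclearNorm X = ∑ i : Fin n₂, sv X i :=
  (Fin.sum_univ_eq_sum_range (sv X) n₂).symm

/-- The indicator of the positive singular values. -/
def svInd (X : Matrix (Fin n₁) (Fin n₂) ℝ) (i : Fin n₂) : ℝ := if sv X i = 0 then 0 else 1

theorem svInd_mul (X : Matrix (Fin n₁) (Fin n₂) ℝ) (i : Fin n₂) : svInd X i * sv X i = sv X i := by
  unfold svInd; split_ifs with h <;> simp [h]

theorem svInd_mul_self (X : Matrix (Fin n₁) (Fin n₂) ℝ) (i : Fin n₂) :
    svInd X i * svInd X i = svInd X i := by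
  unfold svInd; split_ifs <;> simp

theorem svInd_le_one (X : Matrix (Fin n₁) (Fin n₂) ℝ) (i : Fin n₂) : svInd X i ≤ 1 := by
  unfold svInd; split_ifs <;> simp

theorem sum_svInd (X : Matrix (Fin n₁) (Fin n₂) ℝ) : ∑ i, svInd X i ≤ X.rank := by
  have hrank : X.rank = Module.finrank ℝ (LinearMap.range (Matrix.toEuclideanLin X)) := by
    rw [Matrix.rank_eq_finrank_range_toLin X (PiLp.basisFun 2 ℝ (Fin n₁))
      (PiLp.basisFun 2 ℝ (Fin n₂)), ← Matrix.toLpLin_eq_toLin]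
  have hs : ∀ i : Fin n₂, svInd X i = if (i : ℕ) < X.rank then 1 else 0 := by
    intro i
    have h : sv X i = 0 ↔ X.rank ≤ i := by
      rw [sv, LinearMap.singularValues_eq_zero_iff_le_finrank_range, hrank]
    unfold svInd
    simp only [h, ← not_lt]
    split_ifs <;> rfl
  simp only [hs]
  rw [Fin.sum_univ_eq_sum_range (fun i => if i < X.rank then (1 : ℝ) else 0), Finset.sum_boole]
  have : (Finset.range n₂).filter (fun i => i < X.rank) ⊆ Finset.range X.rank := fun i hi => by
    simp only [Finset.mem_filter, Finset.mem_range] at hi ⊢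
    exact hi.2
  exact_mod_cast (Finset.card_le_card this).trans (by simp)

/-- The factors `U, V` form a singular value decomposition of `X`. -/
structure IsSVD (X : Matrix (Fin n₁) (Fin n₂) ℝ) (U : Matrix (Fin n₁) (Fin n₂) ℝ)
    (V : Matrix (Fin n₂) (Fin n₂) ℝ) : Prop where
  left : Uᵀ * U = diagonal (svInd X)
  left_mul : U * diagonal (svInd X) = U
  right : Vᵀ * V = 1
  eq : X = U * diagonal (fun i : Fin n₂ => sv X i) * Vᵀ

/-- The columns of `V` are eigenvectors of the Gram operator, and those of `U` are their images
divided by the singular values. Since `0⁻¹ = 0`, columns of `U` for zero singular values vanish,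
which is why `Uᵀ * U` is an indicator and not the identity. -/
theorem exists_isSVD (X : Matrix (Fin n₁) (Fin n₂) ℝ) : ∃ U V, IsSVD X U V := by
  let T := Matrix.toEuclideanLin X
  have hn : Module.finrank ℝ (EuclideanSpace ℝ (Fin n₂)) = n₂ := finrank_euclideanSpace_fin
  let v := T.isSymmetric_adjoint_comp_self.eigenvectorBasis hn
  have hTv : ∀ i j, inner ℝ (T (v i)) (T (v j)) = if i = j then sv X i ^ 2 else 0 := by
    intro i j
    have h1 := T.isSymmetric_adjoint_comp_self.apply_eigenvectorBasis hn j
    rw [← T.sq_singularValues_fin hn j] at h1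
    rw [← LinearMap.adjoint_inner_right]
    change inner ℝ (v i) ((LinearMap.adjoint T ∘ₗ T) (v j)) = _
    rw [h1, inner_smul_right, orthonormal_iff_ite.1 v.orthonormal i j]
    split_ifs with h
    · subst h
      simp [sv, T]
    · simp
  let V : Matrix (Fin n₂) (Fin n₂) ℝ := Matrix.of fun a i => v i a
  let U : Matrix (Fin n₁) (Fin n₂) ℝ := Matrix.of fun a i => (sv X i)⁻¹ * T (v i) a
  have hV : Vᵀ * V = 1 := by
    ext i j
    have := orthonormal_iff_ite.1 v.orthonormal i j
    rw [PiLp.inner_apply] at this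
    rw [Matrix.mul_apply, Matrix.one_apply, ← this]
    refine Finset.sum_congr rfl fun a _ => ?_
    rw [Real.inner_apply]
    rfl
  have hXV : X * V = U * diagonal (fun i : Fin n₂ => sv X i) := by
    ext a i
    rw [Matrix.mul_diagonal]
    change T (v i) a = (sv X i)⁻¹ * T (v i) a * sv X i
    by_cases h : sv X i = 0
    · have h2 := hTv i i
      rw [if_pos rfl, h, real_inner_self_eq_norm_sq] at h2
      have h3 : T (v i) = 0 := by
        rw [← norm_eq_zero]
        exact pow_eq_zero_iff two_ne_zero |>.1 (by simpa using h2)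
      simp [h3]
    · field_simp
  refine ⟨U, V, ?_, ?_, hV, ?_⟩
  · ext i j
    rw [Matrix.mul_apply, Matrix.diagonal_apply]
    have h1 : ∑ a, Uᵀ i a * U a j = (sv X i)⁻¹ * (sv X j)⁻¹ * inner ℝ (T (v i)) (T (v j)) := by
      rw [PiLp.inner_apply, Finset.mul_sum]
      refine Finset.sum_congr rfl fun a _ => ?_
      rw [Real.inner_apply]
      change (sv X i)⁻¹ * T (v i) a * ((sv X j)⁻¹ * T (v j) a) = _
      ring
    rw [h1, hTv]
    split_ifs with h
    · subst h
      unfold svInd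
      split_ifs with h0
      · simp [h0]
      · field_simp
    · simp
  · ext a i
    rw [Matrix.mul_diagonal]
    change (sv X i)⁻¹ * T (v i) a * svInd X i = (sv X i)⁻¹ * T (v i) a
    unfold svInd
    split_ifs with h0
    · simp [h0]
    · simp
  · rw [← hXV, Matrix.mul_assoc, mul_eq_one_comm.1 hV, Matrix.mul_one]

/-! ### Trace pairing, contractions and duality with the nuclear norm -/

theorem frobNorm_sq_eq_trace (X : Matrix (Fin n₁) (Fin n₂) ℝ) :
    frobNorm X ^ 2 = (Xᵀ * X).trace := by
  rw [frobNorm_sq, Finset.sum_comm]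
  simp only [Matrix.trace, Matrix.diag, Matrix.mul_apply, Matrix.transpose_apply, sq]

theorem frobNorm_transpose (X : Matrix (Fin n₁) (Fin n₂) ℝ) : frobNorm Xᵀ = frobNorm X := by
  unfold frobNorm
  rw [Finset.sum_comm]
  rfl

theorem abs_trace_transpose_mul_le (X Y : Matrix (Fin n₁) (Fin n₂) ℝ) :
    |(Xᵀ * Y).trace| ≤ frobNorm X * frobNorm Y := by
  have h : (Xᵀ * Y).trace = inner ℝ (entries X) (entries Y) := by
    rw [PiLp.inner_apply, Fintype.sum_prod_type, Finset.sum_comm]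
    simp only [Matrix.trace, Matrix.diag, Matrix.mul_apply, Matrix.transpose_apply,
      Real.inner_apply]
    refine Finset.sum_congr rfl fun b _ => Finset.sum_congr rfl fun a _ => ?_
    rfl
  rw [h, frobNorm_eq_norm, frobNorm_eq_norm]
  exact abs_real_inner_le_norm _ _

/-- The operator norm of `W` is at most `1`. -/
def IsContraction {p n : ℕ} (W : Matrix (Fin p) (Fin n) ℝ) : Prop :=
  ∀ x : Fin n → ℝ, (W *ᵥ x) ⬝ᵥ (W *ᵥ x) ≤ x ⬝ᵥ x

theorem dotProduct_mulVec_self {p n : ℕ} (W : Matrix (Fin p) (Fin n) ℝ) (x : Fin n → ℝ) :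
    (W *ᵥ x) ⬝ᵥ (W *ᵥ x) = x ⬝ᵥ ((Wᵀ * W) *ᵥ x) := by
  rw [← Matrix.mulVec_mulVec, Matrix.dotProduct_mulVec x, Matrix.vecMul_transpose]

theorem dotProduct_self_nonneg_real {n : ℕ} (x : Fin n → ℝ) : 0 ≤ x ⬝ᵥ x :=
  Finset.sum_nonneg fun _ _ => mul_self_nonneg _

theorem dotProduct_sq_le {n : ℕ} (x y : Fin n → ℝ) : (x ⬝ᵥ y) ^ 2 ≤ (x ⬝ᵥ x) * (y ⬝ᵥ y) := by
  have := Finset.sum_mul_sq_le_sq_mul_sq Finset.univ x y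
  simp only [sq] at this ⊢
  exact this

/-- From Cauchy–Schwarz, `‖Wᵀ y‖⁴ = ⟨y, W Wᵀ y⟩² ≤ ‖y‖² ‖W Wᵀ y‖² ≤ ‖y‖² ‖Wᵀ y‖²`. -/
theorem IsContraction.transpose {p n : ℕ} {W : Matrix (Fin p) (Fin n) ℝ} (hW : IsContraction W) :
    IsContraction Wᵀ := by
  intro y
  have h1 : (Wᵀ *ᵥ y) ⬝ᵥ (Wᵀ *ᵥ y) = y ⬝ᵥ (W *ᵥ (Wᵀ *ᵥ y)) := by
    rw [dotProduct_mulVec_self, Matrix.transpose_transpose, Matrix.mulVec_mulVec]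
  have h2 := dotProduct_sq_le y (W *ᵥ (Wᵀ *ᵥ y))
  have h3 := hW (Wᵀ *ᵥ y)
  have h4 := dotProduct_self_nonneg_real (Wᵀ *ᵥ y)
  have h5 := dotProduct_self_nonneg_real y
  rw [← h1] at h2
  by_contra! hcon
  nlinarith [mul_le_mul_of_nonneg_left h3 h5]

theorem IsContraction.frobNorm_mul_le {p n q : ℕ} {W : Matrix (Fin p) (Fin n) ℝ}
    (hW : IsContraction W) (N : Matrix (Fin n) (Fin q) ℝ) : frobNorm (W * N) ≤ frobNorm N := by
  unfold frobNorm
  rw [Finset.sum_comm, Finset.sum_comm (s := (Finset.univ : Finset (Fin n)))]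
  refine Real.sqrt_le_sqrt (Finset.sum_le_sum fun b _ => ?_)
  have := hW (fun a => N a b)
  simp only [sq]
  exact this

section SVD

variable {X U : Matrix (Fin n₁) (Fin n₂) ℝ} {V : Matrix (Fin n₂) (Fin n₂) ℝ}

theorem IsSVD.transpose_mul_self (h : IsSVD X U V) :
    (U * Vᵀ)ᵀ * (U * Vᵀ) = V * diagonal (svInd X) * Vᵀ := by
  rw [Matrix.transpose_mul, Matrix.transpose_transpose, Matrix.mul_assoc, ← Matrix.mul_assoc Uᵀ,
    h.left, Matrix.mul_assoc]

theorem IsSVD.proj_mul_self (h : IsSVD X U V) :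
    (V * diagonal (svInd X) * Vᵀ) * (V * diagonal (svInd X) * Vᵀ) =
      V * diagonal (svInd X) * Vᵀ := by
  have e : (V * diagonal (svInd X) * Vᵀ) * (V * diagonal (svInd X) * Vᵀ) =
      V * (diagonal (svInd X) * (Vᵀ * V) * diagonal (svInd X)) * Vᵀ := by
    simp only [Matrix.mul_assoc]
  rw [e, h.right, Matrix.mul_one, Matrix.diagonal_mul_diagonal]
  simp only [svInd_mul_self]

theorem IsSVD.proj_transpose (h : IsSVD X U V) :
    (V * diagonal (svInd X) * Vᵀ)ᵀ = V * diagonal (svInd X) * Vᵀ := by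
  rw [← h.transpose_mul_self, Matrix.transpose_mul, Matrix.transpose_transpose]

theorem IsSVD.trace_proj (h : IsSVD X U V) :
    (V * diagonal (svInd X) * Vᵀ).trace = ∑ i, svInd X i := by
  rw [Matrix.trace_mul_comm, ← Matrix.mul_assoc, h.right, Matrix.one_mul, Matrix.trace_diagonal]

theorem IsSVD.left_proj_mul_self (h : IsSVD X U V) : (U * Uᵀ) * (U * Uᵀ) = U * Uᵀ := by
  have e : (U * Uᵀ) * (U * Uᵀ) = U * (Uᵀ * U) * Uᵀ := by simp only [Matrix.mul_assoc]
  rw [e, h.left, h.left_mul]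

theorem IsSVD.trace_left_proj (h : IsSVD X U V) : (U * Uᵀ).trace = ∑ i, svInd X i := by
  rw [Matrix.trace_mul_comm, h.left, Matrix.trace_diagonal]

/-- The complement of an orthogonal projection is a contraction. -/
theorem isContraction_one_sub {n : ℕ} {Q : Matrix (Fin n) (Fin n) ℝ} (hQ : Qᵀ = Q)
    (hQ2 : Q * Q = Q) : IsContraction (1 - Q) := by
  intro x
  have h2 : x ⬝ᵥ (Q *ᵥ x) = (Q *ᵥ x) ⬝ᵥ (Q *ᵥ x) := by
    rw [dotProduct_mulVec_self, hQ, hQ2]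
  have h1 : (1 - Q)ᵀ * (1 - Q) = 1 - Q := by
    rw [Matrix.transpose_sub, Matrix.transpose_one, hQ]
    simp [Matrix.sub_mul, Matrix.mul_sub, hQ2]
  rw [dotProduct_mulVec_self, h1, Matrix.sub_mulVec, Matrix.one_mulVec, dotProduct_sub, h2]
  linarith [dotProduct_self_nonneg_real (Q *ᵥ x)]

theorem IsSVD.isContraction_sign (h : IsSVD X U V) : IsContraction (U * Vᵀ) := by
  intro x
  have h1 : x ⬝ᵥ x = (Vᵀ *ᵥ x) ⬝ᵥ (Vᵀ *ᵥ x) := by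
    rw [dotProduct_mulVec_self, Matrix.transpose_transpose, mul_eq_one_comm.1 h.right,
      Matrix.one_mulVec]
  rw [h1, ← Matrix.mulVec_mulVec, dotProduct_mulVec_self, h.left]
  refine Finset.sum_le_sum fun i _ => ?_
  rw [Matrix.mulVec_diagonal]
  nlinarith [svInd_le_one X i, mul_self_nonneg ((Vᵀ *ᵥ x) i)]

/-- The sign matrix `U * Vᵀ` is a contraction that attains the dual bound `IsContraction.trace_le`.
The triangle inequality and the descent estimate both rest on this. -/
theorem IsSVD.trace_sign (h : IsSVD X U V) : ((U * Vᵀ)ᵀ * X).trace = nuclearNorm X := by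
  have e : (U * Vᵀ)ᵀ * X = V * (Uᵀ * U * diagonal (fun i : Fin n₂ => sv X i) * Vᵀ) := by
    conv_lhs => rw [h.eq]
    rw [Matrix.transpose_mul, Matrix.transpose_transpose]
    simp only [Matrix.mul_assoc]
  rw [e, Matrix.trace_mul_comm, Matrix.mul_assoc, h.right, Matrix.mul_one, h.left,
    Matrix.diagonal_mul_diagonal, Matrix.trace_diagonal, nuclearNorm_eq]
  simp only [svInd_mul]

theorem IsSVD.frobNorm_sq (h : IsSVD X U V) : frobNorm X ^ 2 = ∑ i : Fin n₂, sv X i ^ 2 := by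
  have e : Xᵀ * X = V * (diagonal (fun i : Fin n₂ => sv X i) * (Uᵀ * U) *
      diagonal (fun i : Fin n₂ => sv X i) * Vᵀ) := by
    conv_lhs => rw [h.eq]
    rw [Matrix.transpose_mul, Matrix.transpose_mul, Matrix.transpose_transpose,
      Matrix.diagonal_transpose]
    simp only [Matrix.mul_assoc]
  rw [frobNorm_sq_eq_trace, e, Matrix.trace_mul_comm, Matrix.mul_assoc, h.right, Matrix.mul_one,
    h.left, Matrix.diagonal_mul_diagonal, Matrix.diagonal_mul_diagonal, Matrix.trace_diagonal]
  refine Finset.sum_congr rfl fun i _ => ?_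
  rw [mul_assoc, svInd_mul, sq]

end SVD

/-- Contractions are dual to the nuclear norm. -/
theorem IsContraction.trace_le {W : Matrix (Fin n₁) (Fin n₂) ℝ} (hW : IsContraction W)
    (X : Matrix (Fin n₁) (Fin n₂) ℝ) : (Wᵀ * X).trace ≤ nuclearNorm X := by
  obtain ⟨U, V, h⟩ := exists_isSVD X
  have e : Wᵀ * X = (Wᵀ * U * diagonal (fun i : Fin n₂ => sv X i)) * Vᵀ := by
    conv_lhs => rw [h.eq]
    simp only [Matrix.mul_assoc]
  rw [e, Matrix.trace_mul_comm, ← Matrix.mul_assoc, nuclearNorm_eq]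
  refine Finset.sum_le_sum fun i _ => ?_
  rw [Matrix.diag_apply, Matrix.mul_diagonal]
  have h0 := sv_nonneg X i
  suffices hle : (Vᵀ * (Wᵀ * U)) i i ≤ 1 by nlinarith
  have e2 : (Vᵀ * (Wᵀ * U)) i i = (W *ᵥ (fun a => V a i)) ⬝ᵥ (fun a => U a i) := by
    rw [← Matrix.mul_assoc, ← Matrix.transpose_mul]
    rfl
  have hu : (fun a => U a i) ⬝ᵥ (fun a => U a i) ≤ 1 := by
    have : (Uᵀ * U) i i = svInd X i := by rw [h.left, Matrix.diagonal_apply_eq]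
    exact (this.trans_le (svInd_le_one X i) :)
  have hv : (fun a => V a i) ⬝ᵥ (fun a => V a i) = 1 := by
    have : (Vᵀ * V) i i = 1 := by rw [h.right, Matrix.one_apply_eq]
    exact this
  have h1 := hW (fun a => V a i)
  rw [hv] at h1
  have h2 := dotProduct_sq_le (W *ᵥ (fun a => V a i)) (fun a => U a i)
  rw [e2]
  have h3 := dotProduct_self_nonneg_real (fun a => U a i)
  nlinarith [dotProduct_self_nonneg_real (W *ᵥ (fun a => V a i))]

theorem nuclearNorm_add_le (X Y : Matrix (Fin n₁) (Fin n₂) ℝ) :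
    nuclearNorm (X + Y) ≤ nuclearNorm X + nuclearNorm Y := by
  obtain ⟨U, V, h⟩ := exists_isSVD (X + Y)
  rw [← h.trace_sign, Matrix.mul_add, Matrix.trace_add]
  exact add_le_add (h.isContraction_sign.trace_le X) (h.isContraction_sign.trace_le Y)

theorem frobNorm_le_nuclearNorm (X : Matrix (Fin n₁) (Fin n₂) ℝ) :
    frobNorm X ≤ nuclearNorm X := by
  obtain ⟨U, V, h⟩ := exists_isSVD X
  have hn : 0 ≤ nuclearNorm X := by
    rw [nuclearNorm_eq]
    exact Finset.sum_nonneg fun i _ => sv_nonneg X i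
  refine le_of_sq_le_sq ?_ hn
  rw [h.frobNorm_sq, nuclearNorm_eq]
  exact Finset.sum_sq_le_sq_sum_of_nonneg fun i _ => sv_nonneg X i

theorem nuclearNorm_le_sqrt_mul_frobNorm (X : Matrix (Fin n₁) (Fin n₂) ℝ) :
    nuclearNorm X ≤ √n₂ * frobNorm X := by
  obtain ⟨U, V, h⟩ := exists_isSVD X
  refine le_of_sq_le_sq ?_ (mul_nonneg (Real.sqrt_nonneg _) (frobNorm_nonneg X))
  rw [mul_pow, h.frobNorm_sq, nuclearNorm_eq, Real.sq_sqrt (Nat.cast_nonneg _)]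
  simpa using sq_sum_le_card_mul_sum_sq (s := (Finset.univ : Finset (Fin n₂)))
    (f := fun i => sv X i)

/-- Directions that do not increase the nuclear norm at a matrix of rank `k` have a nuclear norm
comparable with the Frobenius norm. -/
theorem nuclearNorm_le_of_descent {X H : Matrix (Fin n₁) (Fin n₂) ℝ} {k : ℕ} (hX : X.rank ≤ k)
    (hH : nuclearNorm (X + H) ≤ nuclearNorm X) : nuclearNorm H ≤ 3 * √k * frobNorm H := by
  obtain ⟨U, V, h⟩ := exists_isSVD X
  obtain ⟨U', V', h'⟩ := exists_isSVD H
  set S := U * Vᵀ with hS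
  set G := U' * V'ᵀ with hG
  set P := U * Uᵀ with hP
  set Q := V * diagonal (svInd X) * Vᵀ with hQ
  have hGc : IsContraction G := h'.isContraction_sign
  have hQt : Qᵀ = Q := h.proj_transpose
  have hQQ : Q * Q = Q := h.proj_mul_self
  have hPt : Pᵀ = P := by rw [hP, Matrix.transpose_mul, Matrix.transpose_transpose]
  have hPP : P * P = P := h.left_proj_mul_self
  have hSS : Sᵀ * S = Q := h.transpose_mul_self
  have hPS : P * S = S := by
    rw [hP, hS]
    calc U * Uᵀ * (U * Vᵀ) = U * (Uᵀ * U) * Vᵀ := by simp only [Matrix.mul_assoc]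
      _ = _ := by rw [h.left, h.left_mul]
  have hPX : P * X = X := by
    have e : P * X = U * (Uᵀ * U) * diagonal (fun i : Fin n₂ => sv X i) * Vᵀ := by
      conv_lhs => rw [h.eq]
      rw [hP]
      simp only [Matrix.mul_assoc]
    rw [e, h.left, h.left_mul, ← h.eq]
  have hk : ∑ i, svInd X i ≤ k := (sum_svInd X).trans (by exact_mod_cast hX)
  have hfS : frobNorm S ≤ √k := by
    refine Real.le_sqrt_of_sq_le ?_
    rw [frobNorm_sq_eq_trace, hSS, h.trace_proj]
    exact hk
  have hfQ : frobNorm Q ≤ √k := by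
    refine Real.le_sqrt_of_sq_le ?_
    rw [frobNorm_sq_eq_trace, hQt, hQQ, h.trace_proj]
    exact hk
  have hfP : frobNorm P ≤ √k := by
    refine Real.le_sqrt_of_sq_le ?_
    rw [frobNorm_sq_eq_trace, hPt, hPP, h.trace_left_proj]
    exact hk
  have hfGQ : frobNorm (G * Q) ≤ √k := (hGc.frobNorm_mul_le Q).trans hfQ
  have hfPG : frobNorm (P * G * (1 - Q)) ≤ √k := by
    rw [← frobNorm_transpose, Matrix.transpose_mul, Matrix.transpose_mul, hPt]
    exact ((isContraction_one_sub hQt hQQ).transpose.frobNorm_mul_le _).trans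
      ((hGc.transpose.frobNorm_mul_le P).trans hfP)
  -- `W` is a subgradient of the nuclear norm at `X`. Here `P` and `Q` project onto the column and
  -- row spaces of `X`; the two summands have orthogonal ranges and live on `Q` and `1 - Q`, so `W`
  -- is a contraction, while its pairing with `X` is `‖X‖_*`. The hypothesis on `H` then forces `⟨W,
  -- H⟩ ≤ 0`.
  set W := S + (1 - P) * G * (1 - Q) with hW
  have h1Pt : (1 - P)ᵀ = 1 - P := by rw [Matrix.transpose_sub, Matrix.transpose_one, hPt]
  have h1Qt : (1 - Q)ᵀ = 1 - Q := by rw [Matrix.transpose_sub, Matrix.transpose_one, hQt]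
  have hSP : Sᵀ * (1 - P) = 0 := by
    rw [Matrix.mul_sub, Matrix.mul_one]
    have := congrArg Matrix.transpose hPS
    rw [Matrix.transpose_mul, hPt] at this
    rw [this, sub_self]
  have hWc : IsContraction W := by
    intro x
    have hcross : (S *ᵥ x) ⬝ᵥ (((1 - P) * G * (1 - Q)) *ᵥ x) = 0 := by
      have e : (S *ᵥ x) ⬝ᵥ (((1 - P) * G * (1 - Q)) *ᵥ x) =
          x ⬝ᵥ ((Sᵀ * (1 - P) * (G * (1 - Q))) *ᵥ x) := by
        rw [Matrix.mul_assoc Sᵀ, ← Matrix.mulVec_mulVec (M := Sᵀ), Matrix.dotProduct_mulVec x,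
          Matrix.vecMul_transpose, Matrix.mul_assoc (1 - P)]
      rw [e, hSP]
      simp
    have hA : (((1 - P) * G * (1 - Q)) *ᵥ x) ⬝ᵥ (((1 - P) * G * (1 - Q)) *ᵥ x) ≤
        x ⬝ᵥ ((1 - Q) *ᵥ x) := by
      have e2 : (1 - Q)ᵀ * (1 - Q) = 1 - Q := by
        rw [h1Qt]
        simp [Matrix.sub_mul, Matrix.mul_sub, hQQ]
      calc _ = ((1 - P) *ᵥ (G *ᵥ ((1 - Q) *ᵥ x))) ⬝ᵥ ((1 - P) *ᵥ (G *ᵥ ((1 - Q) *ᵥ x))) := by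
            simp only [Matrix.mulVec_mulVec, Matrix.mul_assoc]
        _ ≤ (G *ᵥ ((1 - Q) *ᵥ x)) ⬝ᵥ (G *ᵥ ((1 - Q) *ᵥ x)) := isContraction_one_sub hPt hPP _
        _ ≤ ((1 - Q) *ᵥ x) ⬝ᵥ ((1 - Q) *ᵥ x) := hGc _
        _ = _ := by rw [dotProduct_mulVec_self, e2]
    have hB : (S *ᵥ x) ⬝ᵥ (S *ᵥ x) = x ⬝ᵥ (Q *ᵥ x) := by rw [dotProduct_mulVec_self, hSS]
    rw [hW, Matrix.add_mulVec, dotProduct_add, add_dotProduct, add_dotProduct, hB, hcross,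
      dotProduct_comm _ (S *ᵥ x), hcross]
    rw [Matrix.sub_mulVec, Matrix.one_mulVec, dotProduct_sub] at hA
    linarith
  have hWle := (hWc.trace_le (X + H)).trans hH
  -- Pairing `G` with `H` gives `‖H‖_*`; the three other terms have Frobenius norm at most `√k`,
  -- which accounts for the constant `3`.
  have hWt : Wᵀ = Sᵀ + (Gᵀ - (G * Q)ᵀ - (P * G * (1 - Q))ᵀ) := by
    rw [hW, Matrix.transpose_add, ← Matrix.transpose_sub, ← Matrix.transpose_sub]
    congr 2
    simp only [Matrix.sub_mul, Matrix.mul_sub, Matrix.one_mul, Matrix.mul_one]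
    abel
  have hWX : (Wᵀ * X).trace = nuclearNorm X := by
    have e : ((1 - P) * G * (1 - Q))ᵀ * X = 0 := by
      rw [Matrix.transpose_mul, Matrix.transpose_mul, h1Pt, Matrix.mul_assoc, Matrix.mul_assoc,
        Matrix.sub_mul 1 P X, Matrix.one_mul, hPX, sub_self, Matrix.mul_zero, Matrix.mul_zero]
    rw [hW, Matrix.transpose_add, Matrix.add_mul, e, add_zero, hS, h.trace_sign]
  have hWH : (Wᵀ * H).trace = (Sᵀ * H).trace + ((nuclearNorm H - ((G * Q)ᵀ * H).trace) -
      ((P * G * (1 - Q))ᵀ * H).trace) := by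
    rw [hWt, Matrix.add_mul, Matrix.sub_mul, Matrix.sub_mul, Matrix.trace_add,
      Matrix.trace_sub, Matrix.trace_sub, hG, h'.trace_sign]
  rw [Matrix.mul_add, Matrix.trace_add, hWX, hWH] at hWle
  have hf := frobNorm_nonneg H
  have b1 := (abs_le.1 ((abs_trace_transpose_mul_le S H).trans
    (mul_le_mul_of_nonneg_right hfS hf))).1
  have b2 := (abs_le.1 ((abs_trace_transpose_mul_le (G * Q) H).trans
    (mul_le_mul_of_nonneg_right hfGQ hf))).2
  have b3 := (abs_le.1 ((abs_trace_transpose_mul_le (P * G * (1 - Q)) H).trans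
    (mul_le_mul_of_nonneg_right hfPG hf))).2
  linarith

end Nuclear

/-! ### Blocks of singular values and recovery -/

section Recovery

open Matrix

variable {m n₁ n₂ l R : ℕ}

/-- The columns of a matrix, continued by `0`. -/
def paddedCol {p n : ℕ} (U : Matrix (Fin p) (Fin n) ℝ) (i : ℕ) (a : Fin p) : ℝ :=
  if h : i < n then U a ⟨i, h⟩ else 0

theorem paddedCol_fin {p n : ℕ} (U : Matrix (Fin p) (Fin n) ℝ) (i : Fin n) (a : Fin p) :
    paddedCol U i a = U a i := by
  simp [paddedCol]

theorem paddedCol_dotProduct {p n : ℕ} {U : Matrix (Fin p) (Fin n) ℝ} {e : ℕ → ℝ}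
    (he : ∀ i, n ≤ i → e i = 0) (hU : Uᵀ * U = diagonal fun i : Fin n => e i) (i j : ℕ) :
    ∑ a, paddedCol U i a * paddedCol U j a = if i = j then e i else 0 := by
  by_cases hi : i < n
  · by_cases hj : j < n
    · have := congrFun (congrFun hU ⟨i, hi⟩) ⟨j, hj⟩
      rw [Matrix.mul_apply, Matrix.diagonal_apply] at this
      simp only [paddedCol, hi, hj, dif_pos]
      simp only [Matrix.transpose_apply, Fin.mk.injEq] at this
      exact this
    · have : i ≠ j := by omega
      simp [paddedCol, hj, this]
  · have := he i (not_lt.1 hi)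
    simp [paddedCol, hi, this]

theorem sum_range_mul_eq (f : ℕ → ℝ) (J R : ℕ) :
    ∑ i ∈ Finset.range (J * R), f i =
      ∑ j ∈ Finset.range J, ∑ s ∈ Finset.range R, f (j * R + s) := by
  induction J with
  | zero => simp
  | succ J ih => rw [add_mul, one_mul, Finset.sum_range_add, ih, Finset.sum_range_succ]

/-- A matrix is a sum of factored blocks that carry `R` consecutive singular values each. -/
theorem exists_blocks (H : Matrix (Fin n₁) (Fin n₂) ℝ) (hR : 0 < R) :
    ∃ (x : ℕ → LeftFactor R n₁) (y : ℕ → RightFactor R n₂),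
      (∀ j, ‖x j‖ ≤ 1) ∧ (∀ j, ‖y j‖ ^ 2 = ∑ s ∈ Finset.range R, sv H (j * R + s) ^ 2) ∧
      (∀ j, frobNorm (lowRank R n₁ n₂ (x j) (y j)) = ‖y j‖) ∧
      H = ∑ j ∈ Finset.range (n₂ + 1), lowRank R n₁ n₂ (x j) (y j) := by
  obtain ⟨U, V, h⟩ := exists_isSVD H
  let e : ℕ → ℝ := fun i => if sv H i = 0 then 0 else 1
  have heU := paddedCol_dotProduct (U := U) (e := e)
    (fun i hi => by simp only [e, sv_of_le H hi, if_true]) h.left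
  have hV : ∀ i, sv H i ^ 2 * ∑ b, paddedCol V i b ^ 2 = sv H i ^ 2 := by
    intro i
    by_cases hi : i < n₂
    · have : (Vᵀ * V) ⟨i, hi⟩ ⟨i, hi⟩ = 1 := by rw [h.right, Matrix.one_apply_eq]
      rw [Matrix.mul_apply] at this
      simp only [Matrix.transpose_apply, ← sq] at this
      simp only [paddedCol, hi, dif_pos, this, mul_one]
    · simp [sv_of_le H (not_lt.1 hi)]
  -- The left factor holds singular vectors, the right factor holds those of `V` scaled by singular
  -- values. Zero columns of the left factor meet only zero rows of the right one, so the product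
  -- keeps the Frobenius norm.
  let M : ℕ → Matrix (Fin n₁) (Fin R) ℝ := fun j => Matrix.of fun a s => paddedCol U (j * R + s) a
  have hM : ∀ j, (M j)ᵀ * M j = diagonal fun s : Fin R => e (j * R + s) := by
    intro j
    ext s t
    rw [Matrix.mul_apply, Matrix.diagonal_apply]
    simp only [M, Matrix.transpose_apply, Matrix.of_apply]
    rw [heU]
    simp [Fin.ext_iff]
  have hMz : ∀ j (z : Fin R → ℝ), ∑ a, ((M j) *ᵥ z) a ^ 2 = ∑ s : Fin R, e (j * R + s) * z s ^ 2 := by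
    intro j z
    have := dotProduct_mulVec_self (M j) z
    rw [hM] at this
    simp only [dotProduct, Matrix.mulVec_diagonal] at this
    simp only [sq]
    rw [this]
    exact Finset.sum_congr rfl fun s _ => by ring
  let x : ℕ → LeftFactor R n₁ := fun j => LinearMap.toContinuousLinearMap
    (Matrix.toEuclideanLin (M j))
  have hx : ∀ j z a, x j z a = ((M j) *ᵥ z) a := fun j z a => rfl
  let y : ℕ → RightFactor R n₂ := fun j => WithLp.toLp 2 fun b => WithLp.toLp 2 fun s =>
    sv H (j * R + s) * paddedCol V (j * R + s) b
  have hy : ∀ j b s, y j b s = sv H (j * R + s) * paddedCol V (j * R + s) b := fun j b s => rfl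
  have hyn : ∀ j, ‖y j‖ ^ 2 = ∑ b, ∑ s, y j b s ^ 2 := by
    intro j
    rw [PiLp.norm_sq_eq_of_L2]
    exact Finset.sum_congr rfl fun b _ => EuclideanSpace.real_norm_sq_eq _
  refine ⟨x, y, ?_, ?_, ?_, ?_⟩
  · intro j
    refine ContinuousLinearMap.opNorm_le_bound _ zero_le_one fun z => ?_
    rw [one_mul]
    refine le_of_sq_le_sq ?_ (norm_nonneg z)
    rw [EuclideanSpace.real_norm_sq_eq, EuclideanSpace.real_norm_sq_eq]
    simp only [hx]
    rw [hMz]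
    refine Finset.sum_le_sum fun s _ => ?_
    have : e (j * R + s) ≤ 1 := by simp only [e]; split_ifs <;> simp
    nlinarith [sq_nonneg (z s)]
  · intro j
    rw [hyn, Finset.sum_comm, ← Fin.sum_univ_eq_sum_range (fun s => sv H (j * R + s) ^ 2) R]
    refine Finset.sum_congr rfl fun s _ => ?_
    rw [← hV]
    simp only [hy, mul_pow, Finset.mul_sum]
  · intro j
    have hsq : frobNorm (lowRank R n₁ n₂ (x j) (y j)) ^ 2 = ‖y j‖ ^ 2 := by
      rw [frobNorm_sq, Finset.sum_comm, hyn]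
      refine Finset.sum_congr rfl fun b _ => ?_
      simp only [lowRank_apply, hx]
      rw [hMz]
      refine Finset.sum_congr rfl fun s _ => ?_
      rw [hy, mul_pow]
      simp only [e]
      split_ifs with h0 <;> simp [h0]
    exact (sq_eq_sq₀ (frobNorm_nonneg _) (norm_nonneg _)).1 hsq
  · ext a b
    have h1 : H a b = ∑ i : Fin n₂, paddedCol U i a * (sv H i * paddedCol V i b) := by
      conv_lhs => rw [h.eq]
      rw [Matrix.mul_apply]
      refine Finset.sum_congr rfl fun i _ => ?_
      rw [Matrix.mul_diagonal, Matrix.transpose_apply, paddedCol_fin, paddedCol_fin, mul_assoc]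
    rw [h1, Fin.sum_univ_eq_sum_range (fun i => paddedCol U i a * (sv H i * paddedCol V i b)),
      Matrix.sum_apply]
    have h2 : ∑ i ∈ Finset.range n₂, paddedCol U i a * (sv H i * paddedCol V i b) =
        ∑ i ∈ Finset.range ((n₂ + 1) * R), paddedCol U i a * (sv H i * paddedCol V i b) := by
      refine Finset.sum_subset (Finset.range_subset_range.2 (by nlinarith)) fun i _ hi => ?_
      rw [Finset.mem_range, not_lt] at hi
      simp [sv_of_le H hi]
    rw [h2, sum_range_mul_eq]
    refine Finset.sum_congr rfl fun j _ => ?_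
    rw [lowRank_apply, hx]
    exact (Fin.sum_univ_eq_sum_range (fun s => paddedCol U (j * R + s) a *
      (sv H (j * R + s) * paddedCol V (j * R + s) b)) R).symm

/-- The blocks after the first one are controlled by the nuclear norm. -/
theorem sum_tail_le (H : Matrix (Fin n₁) (Fin n₂) ℝ) (hR : 0 < R) {y : ℕ → ℝ}
    (hy : ∀ j, y j ^ 2 = ∑ s ∈ Finset.range R, sv H (j * R + s) ^ 2) :
    √R * ∑ j ∈ Finset.range n₂, y (j + 1) ≤ nuclearNorm H := by
  have hR0 : (0 : ℝ) < R := by exact_mod_cast hR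
  -- By monotonicity every singular value of block `j + 1` is at most each one of block `j`, so an
  -- `ℓ²` norm is traded for the `ℓ¹` norm of the preceding block.
  have hj : ∀ j, √R * y (j + 1) ≤ ∑ s ∈ Finset.range R, sv H (j * R + s) := by
    intro j
    have h1 : y (j + 1) ≤ √R * sv H ((j + 1) * R) := by
      refine le_of_sq_le_sq ?_ (mul_nonneg (Real.sqrt_nonneg _) (sv_nonneg _ _))
      rw [hy, mul_pow, Real.sq_sqrt hR0.le]
      calc _ ≤ ∑ s ∈ Finset.range R, sv H ((j + 1) * R) ^ 2 :=
            Finset.sum_le_sum fun s _ => pow_le_pow_left₀ (sv_nonneg _ _)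
              (sv_antitone H (Nat.le_add_right _ _)) 2
        _ = _ := by simp
    calc √R * y (j + 1) ≤ √R * (√R * sv H ((j + 1) * R)) := by gcongr
      _ = ∑ s ∈ Finset.range R, sv H ((j + 1) * R) := by
          rw [← mul_assoc, Real.mul_self_sqrt hR0.le]; simp
      _ ≤ _ := Finset.sum_le_sum fun s hs => sv_antitone H (by
          rw [Finset.mem_range] at hs
          rw [add_mul]; omega)
  rw [Finset.mul_sum]
  calc _ ≤ ∑ j ∈ Finset.range n₂, ∑ s ∈ Finset.range R, sv H (j * R + s) :=
        Finset.sum_le_sum fun j _ => hj j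
    _ = ∑ i ∈ Finset.range (n₂ * R), sv H i := (sum_range_mul_eq _ _ _).symm
    _ = nuclearNorm H := by
        symm
        refine Finset.sum_subset (Finset.range_subset_range.2 (by nlinarith)) fun i _ hi => ?_
        rw [Finset.mem_range, not_lt] at hi
        exact sv_of_le H hi

/-- Uniform bounds over low-rank matrices give a lower bound for all matrices whose nuclear norm
is small. -/
theorem HasLowRankBounds.le_l2Norm {B : Matrix (Fin l) (Fin m) ℝ}
    {A : Fin m → Matrix (Fin n₁) (Fin n₂) ℝ} {U η : ℝ} (h : HasLowRankBounds B A R U) (hR : 0 < R)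
    (hU : 0 < U) (hη : η * (8 * U + 2) ≤ 1) {H : Matrix (Fin n₁) (Fin n₂) ℝ}
    (hH : nuclearNorm H ≤ η * √R * frobNorm H) :
    1 / 8 * √l * frobNorm H ≤ l2Norm (B *ᵥ measurement A H) := by
  obtain ⟨x, y, hx, hy, hxy, hsum⟩ := exists_blocks H hR
  have hR0 : (0 : ℝ) < √R := Real.sqrt_pos.2 (by exact_mod_cast hR)
  have htail := (sum_tail_le H hR (y := fun j => ‖y j‖) hy).trans hH
  set τ := ∑ j ∈ Finset.range n₂, ‖y (j + 1)‖ with hτ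
  have hτle : τ ≤ η * frobNorm H := by
    by_contra! hcon
    have := mul_lt_mul_of_pos_left hcon hR0
    linarith
  let Z : ℕ → Matrix (Fin n₁) (Fin n₂) ℝ := fun j => lowRank R n₁ n₂ (x j) (y j)
  have hHZ : H = (∑ j ∈ Finset.range n₂, Z (j + 1)) + Z 0 := by
    rw [← Finset.sum_range_succ' Z]
    exact hsum
  have hfro : frobNorm H ≤ τ + ‖y 0‖ := by
    conv_lhs => rw [hHZ]
    refine (frobNorm_add_le _ _).trans (add_le_add ((frobNorm_sum_le _ _).trans (le_of_eq ?_))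
      (hxy 0).le)
    exact Finset.sum_congr rfl fun j _ => hxy (j + 1)
  have hl : 0 ≤ √(l : ℝ) := Real.sqrt_nonneg _
  have hT : l2Norm (B *ᵥ measurement A (∑ j ∈ Finset.range n₂, Z (j + 1))) ≤ U * √l * τ := by
    have e : B *ᵥ measurement A (∑ j ∈ Finset.range n₂, Z (j + 1)) =
        ∑ j ∈ Finset.range n₂, B *ᵥ measurement A (Z (j + 1)) := by
      rw [map_sum, Matrix.mulVec_sum]
    rw [e, hτ, Finset.mul_sum]
    refine (l2Norm_sum_le _ _).trans (Finset.sum_le_sum fun j _ => ((h _ _).1).trans ?_)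
    have := hx (j + 1)
    calc U * √l * ‖x (j + 1)‖ * ‖y (j + 1)‖ ≤ U * √l * 1 * ‖y (j + 1)‖ := by gcongr
      _ = _ := by ring
  have h0 : 1 / 4 * √l * ‖y 0‖ ≤ l2Norm (B *ᵥ measurement A (Z 0)) := (h _ _).2 (hx 0) (hxy 0)
  have hZ0 : B *ᵥ measurement A (Z 0) = B *ᵥ measurement A H -
      B *ᵥ measurement A (∑ j ∈ Finset.range n₂, Z (j + 1)) := by
    conv_rhs => rw [hHZ]
    rw [map_add, Matrix.mulVec_add]
    abel
  rw [hZ0] at h0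
  have h1 := l2Norm_sub_le (B *ᵥ measurement A H)
    (B *ᵥ measurement A (∑ j ∈ Finset.range n₂, Z (j + 1)))
  have hf := frobNorm_nonneg H
  have h2 : √l * (1 / 4 * frobNorm H - (1 / 4 + U) * τ) ≤ l2Norm (B *ᵥ measurement A H) := by
    have : √l * frobNorm H ≤ √l * (τ + ‖y 0‖) := by gcongr
    linarith
  -- The tail costs `τ / 4` in the leading block and `U τ` in its own measurements; the condition on
  -- `η` makes this at most half of `‖H‖_F / 4`.
  have h3 : (1 / 4 + U) * τ ≤ 1 / 8 * frobNorm H := by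
    calc (1 / 4 + U) * τ ≤ (1 / 4 + U) * (η * frobNorm H) := by gcongr
      _ = (η * (8 * U + 2)) * (1 / 8 * frobNorm H) := by ring
      _ ≤ 1 * (1 / 8 * frobNorm H) := by gcongr
      _ = _ := one_mul _
  have h4 : √l * ((1 / 4 + U) * τ) ≤ √l * (1 / 8 * frobNorm H) := by gcongr
  linarith

end Recovery

/-! ### The decoder -/

section Decoder

variable {m n₁ n₂ : ℕ}

theorem continuous_frobNorm : Continuous (frobNorm (n₁ := n₁) (n₂ := n₂)) := by
  unfold frobNorm
  fun_prop

theorem abs_nuclearNorm_sub_le (X Y : Matrix (Fin n₁) (Fin n₂) ℝ) :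
    |nuclearNorm X - nuclearNorm Y| ≤ √n₂ * frobNorm (X - Y) := by
  have h1 := nuclearNorm_add_le Y (X - Y)
  have h2 := nuclearNorm_add_le X (Y - X)
  rw [add_sub_cancel] at h1 h2
  have h3 : frobNorm (Y - X) = frobNorm (X - Y) := by
    rw [← neg_sub X Y, frobNorm_eq_norm, map_neg, norm_neg, ← frobNorm_eq_norm]
  have h4 := nuclearNorm_le_sqrt_mul_frobNorm (X - Y)
  have h5 := nuclearNorm_le_sqrt_mul_frobNorm (Y - X)
  rw [h3] at h5
  rw [abs_le]
  constructor <;> linarith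

theorem continuous_nuclearNorm : Continuous (nuclearNorm (n₁ := n₁) (n₂ := n₂)) := by
  rw [continuous_iff_continuousAt]
  intro X
  rw [ContinuousAt, tendsto_iff_norm_sub_tendsto_zero]
  have hc : Continuous fun Y : Matrix (Fin n₁) (Fin n₂) ℝ => √n₂ * frobNorm (Y - X) :=
    continuous_const.mul (continuous_frobNorm.comp (continuous_id.sub continuous_const))
  have h0 : √n₂ * frobNorm (X - X) = 0 := by simp [frobNorm]
  exact squeeze_zero (fun _ => norm_nonneg _) (fun Y => abs_nuclearNorm_sub_le Y X)
    (h0 ▸ hc.tendsto X)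

theorem abs_apply_le_frobNorm (X : Matrix (Fin n₁) (Fin n₂) ℝ) (a : Fin n₁) (b : Fin n₂) :
    |X a b| ≤ frobNorm X := by
  rw [frobNorm_eq_norm]
  exact PiLp.norm_apply_le (entries X) (a, b)

theorem eq_zero_of_l2Norm_le_zero {v : Fin m → ℝ} (h : l2Norm v ≤ 0) : v = 0 := by
  rw [l2Norm_eq_norm] at h
  have := norm_le_zero_iff.1 h
  exact congrArg WithLp.ofLp this

/-- Without measurement noise a decoder output exists as soon as there is a feasible point. -/
theorem exists_isDecoded (M : Matrix (Fin n₁) (Fin n₂) ℝ →ₗ[ℝ] (Fin m → ℝ)) (r : ℕ) (γ : ℝ)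
    (q : Fin m → ℝ) (X : Matrix (Fin n₁) (Fin n₂) ℝ)
    (hX : l2Norm (((diffMatrix m)⁻¹ ^ r).mulVec (M X - q)) ≤ γ * √m) :
    ∃ X' ν', IsDecoded M r γ 0 q X' ν' := by
  let f : Matrix (Fin n₁) (Fin n₂) ℝ → ℝ := fun Z =>
    l2Norm (((diffMatrix m)⁻¹ ^ r).mulVec (M Z - q))
  have hMc : Continuous M := M.continuous_of_finiteDimensional
  have hf : Continuous f := by
    have h1 : Continuous fun Z => ((diffMatrix m)⁻¹ ^ r).mulVec (M Z - q) :=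
      continuous_const.matrix_mulVec (hMc.sub continuous_const)
    have h2 : Continuous (l2Norm (m := m)) := by unfold l2Norm; fun_prop
    exact h2.comp h1
  -- Competitors with nuclear norm at most that of `X` lie in this compact box, because entries are
  -- bounded by the nuclear norm; others cannot beat the minimizer found inside it.
  let K : Set (Matrix (Fin n₁) (Fin n₂) ℝ) :=
    Set.univ.pi fun _ => Set.univ.pi fun _ => Set.Icc (-nuclearNorm X) (nuclearNorm X)
  have hK : IsCompact K := isCompact_univ_pi fun _ => isCompact_univ_pi fun _ => isCompact_Icc
  have hmemK : ∀ Z, nuclearNorm Z ≤ nuclearNorm X → Z ∈ K := by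
    intro Z hZ a _ b _
    exact abs_le.1 ((abs_apply_le_frobNorm Z a b).trans ((frobNorm_le_nuclearNorm Z).trans hZ))
  have hS : IsCompact (K ∩ {Z | f Z ≤ γ * √m}) :=
    hK.inter_right (isClosed_le hf continuous_const)
  obtain ⟨X', hX', hmin⟩ := hS.exists_isMinOn ⟨X, hmemK X le_rfl, hX⟩
    continuous_nuclearNorm.continuousOn
  refine ⟨X', 0, ⟨?_, ?_⟩, ?_⟩
  · rw [add_zero]
    exact hX'.2
  · simp [l2Norm]
  · intro Z ν hZ
    have hν : ν = 0 := eq_zero_of_l2Norm_le_zero (by simpa using hZ.2)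
    have hZ1 := hZ.1
    rw [hν, add_zero] at hZ1
    by_cases h : nuclearNorm Z ≤ nuclearNorm X
    · exact hmin ⟨hmemK Z h, hZ1⟩
    · exact (hmin ⟨hmemK X le_rfl, hX⟩).trans (not_le.1 h).le

theorem inv_pow_mul_diffMatrix_pow (m r : ℕ) : (diffMatrix m)⁻¹ ^ r * diffMatrix m ^ r = 1 :=
  mul_eq_one_comm.1 (diffMatrix_pow_mul_inv_pow m r)

theorem Scheme.inv_pow_mulVec_sub_quantize {r : ℕ} {β : ℝ} (Q : Scheme r β) (y : Fin m → ℝ) :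
    ((diffMatrix m)⁻¹ ^ r).mulVec (y - Q.quantize y) = Q.state y := by
  have h : Q.IsState y (Q.state y) := (Q.existsUnique_isState y).choose_spec.1
  unfold Scheme.IsState at h
  rw [Scheme.quantize, ← h, Matrix.mulVec_mulVec, inv_pow_mul_diffMatrix_pow, Matrix.one_mulVec]

theorem l2Norm_le_of_abs_le {u : Fin m → ℝ} {γ : ℝ} (h : ∀ i, |u i| ≤ γ) :
    l2Norm u ≤ γ * √m := by
  rcases Nat.eq_zero_or_pos m with rfl | hm
  · simp [l2Norm]
  · have hγ : 0 ≤ γ := (abs_nonneg _).trans (h ⟨0, hm⟩)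
    refine le_of_sq_le_sq ?_ (by positivity)
    rw [l2Norm_sq, mul_pow, Real.sq_sqrt (Nat.cast_nonneg _)]
    calc ∑ i, u i ^ 2 ≤ ∑ _i : Fin m, γ ^ 2 := Finset.sum_le_sum fun i _ => by
          rw [← sq_abs]; exact pow_le_pow_left₀ (abs_nonneg _) (h i) 2
      _ = _ := by simp [mul_comm]

/-- The error of the decoder for a fixed draw of the measurements. -/
theorem decoder_error_le {l k R r : ℕ} {B : Matrix (Fin l) (Fin m) ℝ}
    {A : Fin m → Matrix (Fin n₁) (Fin n₂) ℝ} {U η ρ : ℝ} (h : HasLowRankBounds B A R U)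
    (hR : 0 < R) (hU : 0 < U) (hη : η * (8 * U + 2) ≤ 1) (hk : 3 * √(k : ℝ) ≤ η * √(R : ℝ))
    (hρ : 0 ≤ ρ) (hB : ∀ u, l2Norm ((B * diffMatrix m ^ r).mulVec u) ≤ ρ * l2Norm u)
    {β γ : ℝ} {Q : Scheme r β} (hQ : Q.IsStable γ) {X : Matrix (Fin n₁) (Fin n₂) ℝ}
    (hX : X.rank ≤ k) (hX1 : ∀ i, |measurement A X i| ≤ 1) :
    (∃ X' ν', IsDecoded (measurement A) r γ 0 (Q.quantize (measurement A X)) X' ν') ∧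
    ∀ X' ν', IsDecoded (measurement A) r γ 0 (Q.quantize (measurement A X)) X' ν' →
      √l * frobNorm (X' - X) ≤ 16 * ρ * γ * √m := by
  set q := Q.quantize (measurement A X) with hq
  have hfeas : l2Norm (((diffMatrix m)⁻¹ ^ r).mulVec (measurement A X - q)) ≤ γ * √m := by
    rw [hq, Q.inv_pow_mulVec_sub_quantize]
    exact l2Norm_le_of_abs_le (hQ m _ hX1)
  refine ⟨exists_isDecoded _ r γ q X hfeas, fun X' ν' hX' => ?_⟩
  have hν : ν' = 0 := eq_zero_of_l2Norm_le_zero (by simpa using hX'.1.2)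
  have hX'1 := hX'.1.1
  rw [hν, add_zero] at hX'1
  have hnuc : nuclearNorm (X + (X' - X)) ≤ nuclearNorm X := by
    rw [add_sub_cancel]
    refine hX'.2 X 0 ⟨?_, ?_⟩
    · rw [add_zero]; exact hfeas
    · simp [l2Norm]
  have hdesc := nuclearNorm_le_of_descent hX hnuc
  have hlow := h.le_l2Norm hR hU hη
    (hdesc.trans (mul_le_mul_of_nonneg_right hk (frobNorm_nonneg _)))
  -- Inserting `D^r D^{-r}` turns the two feasibility bounds into a bound on `B M(X' - X)`; the data
  -- `q` cancels.
  have hBM : B.mulVec (measurement A (X' - X)) = (B * diffMatrix m ^ r).mulVec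
      (((diffMatrix m)⁻¹ ^ r).mulVec (measurement A X' - q) -
        ((diffMatrix m)⁻¹ ^ r).mulVec (measurement A X - q)) := by
    rw [← Matrix.mulVec_sub, sub_sub_sub_cancel_right, ← map_sub, Matrix.mulVec_mulVec,
      Matrix.mul_assoc, diffMatrix_pow_mul_inv_pow, Matrix.mul_one]
  rw [hBM] at hlow
  have h2 := hlow.trans ((hB _).trans (mul_le_mul_of_nonneg_left
    ((l2Norm_sub_le _ _).trans (add_le_add hX'1 hfeas)) hρ))
  linarith

end Decoder

/-! ### The choice of the order -/

section Order

/-- The oversampling rate leaves room for the splines of the chosen order. -/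
theorem mul_succ_order_le {m l r : ℕ} {lam C₁ : ℝ} (hl : 0 < l) (hlm : l ≤ m) (hC : 1 ≤ C₁)
    (hlam : lam = (m : ℝ) / l) (hr : r = ⌊√(lam / (2 * C₁ * Real.exp 1))⌋₊) :
    l * (r + 1) ≤ m := by
  rcases Nat.eq_zero_or_pos r with h0 | hpos
  · rw [h0]; omega
  have hl0 : (0 : ℝ) < l := by exact_mod_cast hl
  have hr1 : (1 : ℝ) ≤ r := by exact_mod_cast hpos
  have hlam0 : 0 ≤ lam := by rw [hlam]; positivity
  have he : 1 ≤ Real.exp 1 := Real.one_le_exp zero_le_one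
  have hD : 2 ≤ 2 * C₁ * Real.exp 1 := by nlinarith
  have h1 : (r : ℝ) ≤ √(lam / (2 * C₁ * Real.exp 1)) := by
    rw [hr]; exact Nat.floor_le (Real.sqrt_nonneg _)
  have h2 : (r : ℝ) ^ 2 ≤ lam / (2 * C₁ * Real.exp 1) :=
    (Real.le_sqrt (by positivity) (by positivity)).1 h1
  have h3 : lam / (2 * C₁ * Real.exp 1) ≤ lam / 2 := by gcongr
  -- For `r ≥ 1`, `r + 1 ≤ 2 r ≤ 2 r² ≤ λ`.
  have h4 : (r : ℝ) + 1 ≤ lam := by nlinarith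
  rw [hlam, le_div_iff₀ hl0] at h4
  have : (l : ℝ) * (r + 1) ≤ m := by linarith
  exact_mod_cast this

/-- The root-exponential decay for the chosen order. -/
theorem order_error_le {m l r : ℕ} {lam C C₁ β γ : ℝ} (hl : 0 < l) (hlm : l ≤ m) (hC : 0 < C)
    (hC₁ : 1 ≤ C₁) (hCC : 4 * C * Real.exp 2 ≤ C₁) (hlam : lam = (m : ℝ) / l)
    (hr : r = ⌊√(lam / (2 * C₁ * Real.exp 1))⌋₊) (hβ : 0 < β)
    (hγ : γ ≤ C ^ r * (r : ℝ) ^ r * β) :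
    16 * ((r + 1) * (2 / ((m / (l * (r + 1)) : ℕ) : ℝ)) ^ r) * γ * √lam ≤
      16 * Real.exp 2 * √(2 * C₁ * Real.exp 1) * β *
        Real.exp (-(1 / √(2 * C₁ * Real.exp 1)) * √lam) := by
  have hroom := mul_succ_order_le hl hlm hC₁ hlam hr
  set w := m / (l * (r + 1)) with hw
  set D : ℝ := 2 * C₁ * Real.exp 1 with hD
  have hl0 : (0 : ℝ) < l := by exact_mod_cast hl
  have hm0 : (0 : ℝ) < m := by exact_mod_cast (lt_of_lt_of_le hl hlm)
  have hlam0 : 0 < lam := by rw [hlam]; positivity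
  have hD0 : 0 < D := by positivity
  have hpos : 0 < l * (r + 1) := Nat.mul_pos hl (Nat.succ_pos r)
  have hw1 : 1 ≤ w := (Nat.one_le_div_iff hpos).2 hroom
  have hw0 : (0 : ℝ) < w := by exact_mod_cast hw1
  -- Rounding down a number that is at least `1` loses at most a factor `2`.
  have hwlam : lam ≤ 2 * (r + 1) * w := by
    have h1 : m < l * (r + 1) * (w + 1) := Nat.lt_mul_div_succ m hpos
    have h2 : m ≤ l * (r + 1) * (2 * w) := h1.le.trans (Nat.mul_le_mul_left _ (by omega))
    rw [hlam, div_le_iff₀ hl0]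
    have h3 : (m : ℝ) ≤ l * (r + 1) * (2 * w) := by exact_mod_cast h2
    linarith
  have hratio : 2 / (w : ℝ) ≤ 4 * (r + 1) / lam := by
    rw [div_le_div_iff₀ hw0 hlam0]
    linarith
  have hrfloor : (r : ℝ) ≤ √(lam / D) := by
    rw [hr]; exact Nat.floor_le (Real.sqrt_nonneg _)
  have hr2 : (r : ℝ) ^ 2 ≤ lam / D := (Real.le_sqrt (by positivity) (by positivity)).1 hrfloor
  have hr3 : √(lam / D) < r + 1 := by rw [hr]; exact Nat.lt_floor_add_one _
  have hsqrt : √(lam / D) = 1 / √D * √lam := by rw [Real.sqrt_div' _ hD0.le]; ring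
  have hsD : 0 < √D := Real.sqrt_pos.2 hD0
  -- The base is at most `8 C r² / λ ≤ 8 C / D`, and `C₁ ≥ 4 C e²` makes this at most `e^{-3}`. One
  -- factor `e^{-r}` will absorb `r + 1`; the factor `e^{-2 r}` yields the decay and absorbs `√λ`.
  have hpow : (2 / (w : ℝ)) ^ r * (C ^ r * (r : ℝ) ^ r) ≤ Real.exp (-1) ^ r * Real.exp (-2) ^ r := by
    rcases Nat.eq_zero_or_pos r with h0 | h0
    · simp [h0]
    have hr1 : (1 : ℝ) ≤ r := by exact_mod_cast h0
    rw [← mul_pow, ← mul_pow, ← mul_pow]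
    refine pow_le_pow_left₀ (by positivity) ?_ r
    have he : 0 < Real.exp 1 := Real.exp_pos 1
    have hee : Real.exp (-1) * Real.exp (-2) * (Real.exp 1 * Real.exp 2) = 1 := by
      rw [← Real.exp_add, ← Real.exp_add, ← Real.exp_add]; norm_num
    have hratio' : 2 / (w : ℝ) ≤ 4 * (r + r) / lam := hratio.trans (by gcongr)
    calc 2 / (w : ℝ) * (C * r) ≤ 4 * (r + r) / lam * (C * r) :=
          mul_le_mul_of_nonneg_right hratio' (by positivity)
      _ = 8 * C * r ^ 2 / lam := by ring
      _ ≤ 8 * C * (lam / D) / lam := by gcongr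
      _ = 8 * C / D := by field_simp
      _ ≤ Real.exp (-1) * Real.exp (-2) := by
          rw [div_le_iff₀ hD0, hD]
          have h5 : 8 * C = Real.exp (-1) * Real.exp (-2) * (2 * (4 * C * Real.exp 2) * Real.exp 1) := by
            linear_combination (-8 * C) * hee
          rw [h5]
          gcongr
  have hr1e : ((r : ℝ) + 1) * Real.exp (-1) ^ r ≤ 1 := by
    rw [← Real.exp_nat_mul]
    have h1 := Real.add_one_le_exp (r : ℝ)
    have h2 : Real.exp (r : ℝ) * Real.exp (r * -1) = 1 := by
      rw [← Real.exp_add]; simp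
    calc ((r : ℝ) + 1) * Real.exp (r * -1) ≤ Real.exp r * Real.exp (r * -1) := by gcongr
      _ = 1 := h2
  -- The floor loses at most `1` in `r`, hence the factor `e²`.
  have hexp : Real.exp (-2) ^ r ≤ Real.exp 2 * Real.exp (-(2 * (1 / √D * √lam))) := by
    rw [← Real.exp_nat_mul, ← Real.exp_add, Real.exp_le_exp, ← hsqrt]
    linarith
  have hlin : √lam ≤ √D * Real.exp (1 / √D * √lam) := by
    have h1 := Real.add_one_le_exp (1 / √D * √lam)
    calc √lam = √D * (1 / √D * √lam) := by field_simp
      _ ≤ _ := by gcongr; linarith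
  calc 16 * ((r + 1) * (2 / (w : ℝ)) ^ r) * γ * √lam
      ≤ 16 * ((r + 1) * (2 / (w : ℝ)) ^ r) * (C ^ r * (r : ℝ) ^ r * β) * √lam := by gcongr
    _ = 16 * β * √lam * (r + 1) * ((2 / (w : ℝ)) ^ r * (C ^ r * (r : ℝ) ^ r)) := by ring
    _ ≤ 16 * β * √lam * (r + 1) * (Real.exp (-1) ^ r * Real.exp (-2) ^ r) := by gcongr
    _ = 16 * β * √lam * (((r : ℝ) + 1) * Real.exp (-1) ^ r) * Real.exp (-2) ^ r := by ring
    _ ≤ 16 * β * (√D * Real.exp (1 / √D * √lam)) * 1 *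
        (Real.exp 2 * Real.exp (-(2 * (1 / √D * √lam)))) := by gcongr
    _ = 16 * Real.exp 2 * √D * β *
        (Real.exp (1 / √D * √lam) * Real.exp (-(2 * (1 / √D * √lam)))) := by ring
    _ = _ := by rw [← Real.exp_add]; congr 2; ring

end Order

end SigmaDelta

end

/-! ### Choice of constants and conclusion -/

theorem corollary3p2 (K : ℝ) (hK : 0 < K) :
    ∃ c c₃ C₃ : ℝ, 0 < c ∧ 0 < c₃ ∧ 0 < C₃ ∧
    ∀ C : ℝ, 0 < C →
    ∃ c₁ C₁ C₂ : ℝ, 0 < c₁ ∧ 0 < C₁ ∧ 0 < C₂ ∧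
    ∀ (n₁ n₂ m k ℓ r : ℕ) (lam : ℝ), 1 ≤ k →
      ℓ = ⌈c * k * (max n₁ n₂ : ℕ)⌉₊ → ℓ ≤ m →
      lam = (m : ℝ) / ℓ →
      r = ⌊√(lam / (2 * C₁ * Real.exp 1))⌋₊ →
    ∀ (Ω : Type*) [MeasurableSpace Ω] (P : Measure Ω) [IsProbabilityMeasure P]
      (A : Ω → Fin m → Matrix (Fin n₁) (Fin n₂) ℝ),
      SigmaDelta.IsSubGaussianEnsemble P K A →
    P.real {ω | ¬ ∀ (β : ℝ) (Q : SigmaDelta.Scheme r β) (γ : ℝ), 0 < β →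
        Q.IsStable γ → γ ≤ C ^ r * (r : ℝ) ^ r * β →
        ∀ X : Matrix (Fin n₁) (Fin n₂) ℝ, X.rank ≤ k →
          (∀ i, |SigmaDelta.measurement (A ω) X i| ≤ 1) →
          (∃ X' ν', SigmaDelta.IsDecoded (SigmaDelta.measurement (A ω)) r γ 0
            (Q.quantize (SigmaDelta.measurement (A ω) X)) X' ν') ∧
          ∀ X' ν', SigmaDelta.IsDecoded (SigmaDelta.measurement (A ω)) r γ 0
              (Q.quantize (SigmaDelta.measurement (A ω) X)) X' ν' →
            SigmaDelta.frobNorm (X' - X) ≤ C₂ * β * Real.exp (-c₁ * √lam)}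
      < C₃ * Real.exp (-c₃ * ℓ) := by
  obtain ⟨U, c₀, Θ, hU, hc₀, hΘ, hprob⟩ := SigmaDelta.exists_lowRank_constants hK
  -- Blocks will have `R = t k` singular values. With `η = 3 / √t` one gets `η √R = 3 √k`, matching
  -- the descent estimate, and `η (8 U + 2) ≤ 1` is exactly `24 U + 6 ≤ √t`.
  set t : ℕ := ⌈(24 * U + 6) ^ 2⌉₊ with ht
  have htge : (24 * U + 6) ^ 2 ≤ (t : ℝ) := Nat.le_ceil _
  have ht0 : (0 : ℝ) < t := lt_of_lt_of_le (by positivity) htge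
  -- The constants here depend on `K` alone; `C` enters only through `C₁`. The factor `2` in the
  -- first covers `n₁ + n₂ ≤ 2 max n₁ n₂`, and `3` in place of `2` gives the strict inequality.
  refine ⟨2 * t * Θ, c₀, 3, by positivity, hc₀, by norm_num, fun C hC => ?_⟩
  set C₁ : ℝ := max 1 (4 * C * Real.exp 2) with hC₁
  have hC₁1 : 1 ≤ C₁ := le_max_left _ _
  refine ⟨1 / √(2 * C₁ * Real.exp 1), C₁, 16 * Real.exp 2 * √(2 * C₁ * Real.exp 1),
    by positivity, by positivity, by positivity, ?_⟩
  intro n₁ n₂ m k l r lam hk hl hlm hlam hr Ω _ P _ A hA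
  -- In the degenerate case the claimed bound is `3`, which exceeds any probability.
  rcases Nat.eq_zero_or_pos l with h0 | hl0
  · rw [h0]
    refine lt_of_le_of_lt measureReal_le_one ?_
    norm_num
  have hroom := SigmaDelta.mul_succ_order_le hl0 hlm hC₁1 hlam hr
  have hpos : 0 < l * (r + 1) := Nat.mul_pos hl0 (Nat.succ_pos r)
  set w := m / (l * (r + 1)) with hw
  have hw1 : 1 ≤ w := (Nat.one_le_div_iff hpos).2 hroom
  -- `B` depends only on `l`, `m` and `r`, so a single good event serves all step-sizes, schemes and
  -- matrices `X` simultaneously.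
  obtain ⟨B, hB, hBD⟩ := SigmaDelta.exists_isBlockFrame (l := l) (m := m) (r := r) hw1
    (by rw [← mul_assoc]; exact Nat.mul_div_le m _)
  have hk0 : (0 : ℝ) < k := by exact_mod_cast hk
  have hsize : ((t * k : ℕ) : ℝ) * (n₁ + n₂) * Θ ≤ l := by
    have h1 : 2 * t * Θ * k * (max n₁ n₂ : ℕ) ≤ (l : ℝ) := by rw [hl]; exact Nat.le_ceil _
    have h2 : (n₁ : ℝ) + n₂ ≤ 2 * (max n₁ n₂ : ℕ) := by
      have : n₁ + n₂ ≤ 2 * max n₁ n₂ := by omega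
      exact_mod_cast this
    push_cast at h1 h2 ⊢
    calc (t : ℝ) * k * (n₁ + n₂) * Θ ≤ t * k * (2 * max (n₁ : ℝ) n₂) * Θ := by gcongr
      _ = 2 * t * Θ * k * max (n₁ : ℝ) n₂ := by ring
      _ ≤ l := h1
  have hP := hprob (t * k) hA hB hsize
  have hlt : 2 * Real.exp (-c₀ * l) < 3 * Real.exp (-c₀ * l) := by
    have := Real.exp_pos (-c₀ * l)
    linarith
  refine lt_of_le_of_lt (measureReal_mono ?_ (measure_ne_top _ _)) (lt_of_le_of_lt hP hlt)
  intro ω hω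
  simp only [Set.mem_ofPred_eq] at hω ⊢
  refine fun hgood => hω ?_
  intro β Q γ hβ hQ hγ X hX hX1
  have hst : 24 * U + 6 ≤ √(t : ℝ) := Real.le_sqrt_of_sq_le htge
  have hst0 : 0 < √(t : ℝ) := by positivity
  obtain ⟨hex, herr⟩ := SigmaDelta.decoder_error_le (η := 3 / √(t : ℝ)) (k := k) hgood
    (Nat.mul_pos (by exact_mod_cast ht0) hk) hU
    (by rw [div_mul_eq_mul_div, div_le_one hst0]; linarith)
    (by push_cast; rw [Real.sqrt_mul ht0.le]; field_simp; simp) (by positivity) hBD hQ hX hX1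
  refine ⟨hex, fun X' ν' hX' => ?_⟩
  have h1 := herr X' ν' hX'
  have hl0' : (0 : ℝ) < l := by exact_mod_cast hl0
  have hsl : 0 < √(l : ℝ) := Real.sqrt_pos.2 hl0'
  have hslam : √lam = √m / √l := by rw [hlam, Real.sqrt_div' _ hl0'.le]
  have h2 : SigmaDelta.frobNorm (X' - X) ≤ 16 * ((r + 1) * (2 / (w : ℝ)) ^ r) * γ * √lam := by
    rw [hslam, ← mul_div_assoc, le_div_iff₀ hsl]
    linarith
  exact h2.trans (SigmaDelta.order_error_le hl0 hlm hC hC₁1 (le_max_right _ _) hlam hr hβ hγ)
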